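/- Let $k$ be an algebraically closed field of characteristic $2$, let $V_4=\langle g,h\rangle$ be the Klein four group, and let $\mathcal C$ be the tensor category of finite dimensional $kV_4$-modules. A full subcategory $\mathcal I$ of $\mathcal C$ is called an ideal if it is closed under retracts and $V\otimes W\in\mathcal I$ whenever $V\in\mathcal I$, $W\in\mathcal C$. For an object $V$, let $\mathcal I_V$ be the ideal of all retracts of objects $V\otimes W$, $W\in\mathcal C$, and let $\mathcal Proj$ be the ideal of projective objects. Let $k$ also denote the trivial module, let $D=kV_4$ be the regular module, and let $\Omega^n(k)$, $n\in\mathbb Z$, be the Heller shifts of $k$, defined by iterating kernels of projective covers ($n>0$) and cokernels of injective hulls ($n<0$), with $\Omega^0(k)=k$. For $n\ge 1$ and $\alpha\in k$ let $V_n(\alpha)$ be the module of dimension $2n$ on which $g-1$ and $h-1$ act by $\begin{pmatrix}0&I_n\\0&0\end{pmatrix}$ and $\begin{pmatrix}0&J_n(\alpha)\\0&0\end{pmatrix}$, where $J_n(\alpha)$ is the $n\times n$ Jordan block with eigenvalue $\alpha$; let $V_n(\infty)$ be the module on which $g-1$ and $h-1$ act by $\begin{pmatrix}0&J_n(0)\\0&0\end{pmatrix}$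 and $\begin{pmatrix}0&I_n\\0&0\end{pmatrix}$. Then: 1. $\mathcal Proj=\mathcal I_D$, and $\mathcal Proj$ is contained in every ideal that contains a nonzero object. 2. For every $n\in\mathbb Z$ the Heller shift $\Omega^n(k)$ exists, and $\mathcal I_{\Omega^n(k)}=\mathcal I_k=\mathcal C$. 3. $\mathcal I_{V_m(\infty)}\subsetneq\mathcal I_{V_n(\infty)}$ for all $1\le m<n$. 4. For $\alpha\in k$ and $1\le m<n$ one has $\mathcal I_{V_m(\alpha)}\subsetneq\mathcal I_{V_n(\alpha)}$, except when $m=1$, $n=2$ and $\alpha\ne 0,1$. 5. For $\alpha\in k$ with $\alpha\neq 0,1$ one has $\mathcal I_{V_2(\alpha)}=\mathcal I_{V_1(\alpha)}$. 6. For all $\alpha\in k\cup\{\infty\}$ and $n\ge1$ one has $\mathcal Proj\subsetneq\mathcal I_{V_n(\alpha)}\subsetneq\mathcal I_k$. 7. There are no other containments among the ideals generated by these modules: if $\alpha\ne\beta$ in $k\cup\{\infty\}$ and $m,n\ge1$, then $\mathcal I_{V_m(\alpha)}\not\subseteq\mathcal I_{V_n(\beta)}$. -/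

import Mathlib

universe u

section IdealsAndShifts

open CategoryTheory CategoryTheory.Limits CategoryTheory.MonoidalCategory

/-- A (right) tensor ideal of a monoidal category, as a full subcategory: it is closed under
tensoring with arbitrary objects and under retracts. Closure under direct sums is not required. -/
structure IsTensorIdeal {C : Type*} [Category C] [MonoidalCategory C]
    (I : ObjectProperty C) : Prop where
  tensor : ∀ V W : C, I V → I (V ⊗ W)
  retract : ∀ V W : C, I V → Nonempty (Retract W V) → I W

/-- The ideal `I_V` of all retracts of the objects `V ⊗ W`, for `W` in `C`. -/
def idealOf {C : Type*} [Category C] [MonoidalCategory C] (V : C) : ObjectProperty C :=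
  fun U => ∃ W : C, Nonempty (Retract U (V ⊗ W))

/-- `p : P ⟶ N` is a projective cover: `P` is projective, and `p` is an essential epimorphism. -/
structure IsProjectiveCover {C : Type*} [Category C] {P N : C} (p : P ⟶ N) : Prop where
  projective : Projective P
  epi : Epi p
  essential : ∀ {Q : C} (f : Q ⟶ P), Epi (f ≫ p) → Epi f

/-- `i : M ⟶ E` is an injective hull: `E` is injective, and `i` is an essential monomorphism. -/
structure IsInjectiveHull {C : Type*} [Category C] {M E : C} (i : M ⟶ E) : Prop where
  injective : Injective E
  mono : Mono i
  essential : ∀ {Q : C} (f : E ⟶ Q), Mono (i ≫ f) → Mono f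

/-- `M` is `Ω N`, the kernel of a projective cover of `N`. -/
def IsOmega {C : Type*} [Category C] [HasZeroMorphisms C] (M N : C) : Prop :=
  ∃ (P : C) (p : P ⟶ N) (i : M ⟶ P) (w : i ≫ p = 0),
    IsProjectiveCover p ∧ Nonempty (IsLimit (KernelFork.ofι i w))

/-- `M` is `Ω⁻¹ N`, the cokernel of an injective hull of `N`. -/
def IsOmegaInv {C : Type*} [Category C] [HasZeroMorphisms C] (M N : C) : Prop :=
  ∃ (E : C) (i : N ⟶ E) (p : E ⟶ M) (w : i ≫ p = 0),
    IsInjectiveHull i ∧ Nonempty (IsColimit (CokernelCofork.ofπ p w))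

/-- `IterShift R n M N`: `M` is obtained from `N`, up to isomorphism, by `n` successive steps,
each from some `Y` to some `X` with `R X Y`. -/
def IterShift {C : Type*} [Category C] (R : C → C → Prop) : ℕ → C → C → Prop
  | 0, M, N => Nonempty (M ≅ N)
  | n + 1, M, N => ∃ L : C, R M L ∧ IterShift R n L N

/-- `M` is the Heller shift `Ω^n N`, for `n : ℤ`. -/
def IsHellerShift {C : Type*} [Category C] [HasZeroMorphisms C] : ℤ → C → C → Prop
  | Int.ofNat n, M, N => IterShift IsOmega n M N
  | Int.negSucc n, M, N => IterShift IsOmegaInv (n + 1) M N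

end IdealsAndShifts

section KleinFour

/-- The Klein four group; its generators are `g = (1, 0)` and `h = (0, 1)`. -/
abbrev V4 : Type := Multiplicative (ZMod 2 × ZMod 2)

/-- The element of a field of characteristic two given by an element of `ZMod 2`. -/
def bit (k : Type u) [Field k] [CharP k 2] : ZMod 2 →+* k := ZMod.castHom (dvd_refl 2) k

/-- The representation of the Klein four group on `kⁿ ⊕ kⁿ` in which `g - 1` and `h - 1` act by the
block matrices with upper right blocks `S` and `T`, respectively, and all other blocks zero. -/
def pencilRep {k : Type u} [Field k] [CharP k 2] {n : ℕ} (S T : Matrix (Fin n) (Fin n) k) :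
    Representation k V4 (Fin n ⊕ Fin n → k) where
  toFun x := Matrix.toLin' (Matrix.fromBlocks 1
    (bit k x.toAdd.1 • S + bit k x.toAdd.2 • T) 0 1)
  map_one' := by
    simp [Matrix.fromBlocks_one]
    rfl
  map_mul' x y := by
    rw [Module.End.mul_eq_comp, ← Matrix.toLin'_mul, Matrix.fromBlocks_multiply]
    congr 2
    · simp
    · simp only [toAdd_mul, Prod.fst_add, Prod.snd_add, map_add, add_smul, Matrix.one_mul,
        Matrix.mul_one]
      abel
    · simp
    · simp

/-- The `n × n` Jordan block with eigenvalue `a` and ones below the diagonal. -/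
def jordanBlock {k : Type u} [Field k] (n : ℕ) (a : k) : Matrix (Fin n) (Fin n) k :=
  Matrix.of fun i j => if i = j then a else if (i : ℕ) = (j : ℕ) + 1 then 1 else 0

/-- The `2n`-dimensional module `V_n(α)`, for `α ∈ k ∪ {∞}`. -/
noncomputable def moduleV {k : Type u} [Field k] [CharP k 2] (n : ℕ) : OnePoint k → FDRep k V4
  | none => FDRep.of (pencilRep (jordanBlock n (0 : k)) 1)
  | some a => FDRep.of (pencilRep 1 (jordanBlock n a))

/-- The four-dimensional projective module `D`: the regular representation. -/
noncomputable def moduleD (k : Type u) [Field k] : FDRep k V4 :=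
  FDRep.of (Representation.leftRegular k V4)

/-- The trivial module `k`, the unit object of the category of representations. -/
noncomputable abbrev moduleK (k : Type u) [Field k] : FDRep k V4 :=
  CategoryTheory.MonoidalCategoryStruct.tensorUnit (FDRep k V4)

end KleinFour

/-!
The argument compares ideals through three linear-algebra devices.

*Projectives.* By Higman's criterion an object is projective, and equally injective, when its identity
is a relative trace `∑ g, g f g⁻¹` of a linear map (`IsTraceOne`). The regular representation `D` has
this property, so the projectives are the retracts of the `D ⊗ W`; and `D` is a retract of `X ⊗ D`
for every nonzero `X`, which places the projectives in every nonzero ideal.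

*Heller shifts.* Let `0 ⟶ A ⟶ P ⟶ B ⟶ 0` be exact with `P` projective. Schanuel's lemma makes `B`
agree, modulo projectives, with `A ⊗ (D / k)`, and `A` with `B ⊗ ker (D ⟶ k)`; as ideals absorb
projectives, a nonprojective `A` and `B` generate the same ideal (`idealOf_X₁_eq_X₃`). Projective
covers and injective hulls exist by Fitting's lemma applied to covers and embeddings of least
dimension.

*The modules `V_n(α)`.* Choose generators `a`, `b` of the group such that `a` and `b` act on `V_n(α)`
by the unipotent block matrices with upper right blocks `1` and the Jordan block. Whenever `X` is
free over `⟨a⟩` there is an operator `c` with `c - a c a⁻¹ = 1`, and `τ = c - b c b⁻¹` is an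
endomorphism of `X`, natural modulo projectives and compatible with tensor products; it is the
quotient of the two degree one cohomology classes dual to the generators. On `V_n(α)` it is the
Jordan block plus a nilpotent part, and `(τ - α) ^ n` vanishes modulo projectives, except that the
exponent `2` is needed when `n = 1` and `α ≠ 0, 1`. Such a bound passes from `V_n(α)` to all members of
its ideal (`IsSlopePair.slopeBounded_of_idealOf`), and for `V_m(β)` it forces `β = α` and bounds `m`
by the exponent (`eq_and_le_of_slopeBounded_moduleV`): this gives all the noncontainments. Conversely, if
`(τ - α) ^ n = 0` on `U`, then `U` is a retract of `V_n(α) ⊗ U`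
(`IsPencil.idealOf_of_slopePair`), which gives all the containments except the exceptional one. That
one holds because `V_1(α) ⊗ V_1(α) ≅ V_2(α)` for `α ≠ 0, 1`.
-/

open CategoryTheory CategoryTheory.Limits CategoryTheory.MonoidalCategory TensorProduct

/-! ### Morphisms of representations as linear maps -/

namespace FDRep

variable {k : Type u} [Field k] {G : Type} [Group G]

/-- The linear map underlying a morphism of representations. -/
def lin {X Y : FDRep k G} (f : X ⟶ Y) : X →ₗ[k] Y := f.hom.hom.hom

lemma lin_comp {X Y Z : FDRep k G} (f : X ⟶ Y) (g : Y ⟶ Z) : lin (f ≫ g) = lin g ∘ₗ lin f := rfl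

lemma lin_injective {X Y : FDRep k G} {f g : X ⟶ Y} (h : lin f = lin g) : f = g :=
  Action.Hom.ext (FGModuleCat.hom_ext h)

lemma lin_ρ {X Y : FDRep k G} (f : X ⟶ Y) (g : G) (x : X) :
    lin f (X.ρ g x) = Y.ρ g (lin f x) :=
  LinearMap.congr_fun (congrArg (fun φ => φ.hom.hom) (f.comm g)) x

/-- The morphism of representations given by an equivariant linear map. -/
def homMk {X Y : FDRep k G} (f : X →ₗ[k] Y) (h : ∀ g x, f (X.ρ g x) = Y.ρ g (f x)) : X ⟶ Y where
  hom := InducedCategory.homMk (ModuleCat.ofHom f)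
  comm g := FGModuleCat.hom_ext (LinearMap.ext (h g))

lemma tensor_ρ_tmul (X Y : FDRep k G) (g : G) (x : X) (y : Y) :
    (X ⊗ Y).ρ g (x ⊗ₜ[k] y : X ⊗[k] Y) = (X.ρ g x ⊗ₜ[k] Y.ρ g y : X ⊗[k] Y) := rfl

lemma equivariant_of_tmul {X Y Z : FDRep k G} (f : X ⊗[k] Y →ₗ[k] Z)
    (h : ∀ g x y, f (X.ρ g x ⊗ₜ[k] Y.ρ g y) = Z.ρ g (f (x ⊗ₜ[k] y))) (g : G) (t : X ⊗[k] Y) :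
    f ((X ⊗ Y).ρ g t) = Z.ρ g (f t) := by
  have : f ∘ₗ TensorProduct.map (X.ρ g) (Y.ρ g) = Z.ρ g ∘ₗ f :=
    TensorProduct.ext' fun x y => h g x y
  exact LinearMap.congr_fun this t

theorem epi_iff {X Y : FDRep k G} (f : X ⟶ Y) : Epi f ↔ Function.Surjective (lin f) := by
  have : Epi f ↔ Epi ((Action.forget _ _ ⋙ forget₂ (FGModuleCat k) (ModuleCat k)).map f) :=
    ⟨fun _ => inferInstance, fun h => Functor.epi_of_epi_map _ h⟩
  rw [this, ModuleCat.epi_iff_surjective]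
  rfl

theorem mono_iff {X Y : FDRep k G} (f : X ⟶ Y) : Mono f ↔ Function.Injective (lin f) := by
  have : Mono f ↔ Mono ((Action.forget _ _ ⋙ forget₂ (FGModuleCat k) (ModuleCat k)).map f) :=
    ⟨fun _ => inferInstance, fun h => Functor.mono_of_mono_map _ h⟩
  rw [this, ModuleCat.mono_iff_injective]
  rfl

end FDRep

/-! ### Relative traces, projective and injective representations -/

namespace FDRep

variable {k : Type u} [Field k] {G : Type} [Group G] [Fintype G]

/-- The relative trace `f ↦ ∑ g, g ∘ f ∘ g⁻¹`, from linear maps to morphisms of representations. -/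
noncomputable def average {X Y : FDRep k G} (f : X →ₗ[k] Y) : X ⟶ Y :=
  homMk (∑ g, Y.ρ g ∘ₗ f ∘ₗ X.ρ g⁻¹) fun h x => by
    simp only [LinearMap.sum_apply, LinearMap.comp_apply, map_sum]
    refine Fintype.sum_equiv (Equiv.mulLeft h⁻¹) _ _ fun g => ?_
    simp [← Module.End.mul_apply, ← map_mul]

lemma lin_average {X Y : FDRep k G} (f : X →ₗ[k] Y) :
    lin (average f) = ∑ g, Y.ρ g ∘ₗ f ∘ₗ X.ρ g⁻¹ := rfl

lemma lin_average_apply {X Y : FDRep k G} (f : X →ₗ[k] Y) (x : X) :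
    lin (average f) x = ∑ g, Y.ρ g (f (X.ρ g⁻¹ x)) := by
  simp [lin_average, LinearMap.sum_apply]

lemma average_comp {X Y Z : FDRep k G} (f : X →ₗ[k] Y) (h : Y ⟶ Z) :
    average f ≫ h = average (lin h ∘ₗ f) := by
  refine lin_injective (LinearMap.ext fun x => ?_)
  simp [lin_comp, lin_average_apply, lin_ρ]

lemma comp_average {X Y Z : FDRep k G} (h : X ⟶ Y) (f : Y →ₗ[k] Z) :
    h ≫ average f = average (f ∘ₗ lin h) := by
  refine lin_injective (LinearMap.ext fun x => ?_)
  simp [lin_comp, lin_average_apply, lin_ρ]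

/-- Higman's criterion: the identity is a relative trace. It characterises both the projective and
the injective objects. -/
def IsTraceOne (X : FDRep k G) : Prop := ∃ f : X →ₗ[k] X, average f = 𝟙 X

lemma IsTraceOne.retract {X Y : FDRep k G} (hX : IsTraceOne X) (r : Retract Y X) :
    IsTraceOne Y := by
  obtain ⟨f, hf⟩ := hX
  refine ⟨lin r.r ∘ₗ f ∘ₗ lin r.i, ?_⟩
  rw [← average_comp, ← comp_average, hf]
  simp

lemma IsTraceOne.tensor {X : FDRep k G} (hX : IsTraceOne X) (Y : FDRep k G) :
    IsTraceOne (X ⊗ Y) := by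
  obtain ⟨f, hf⟩ := hX
  refine ⟨(TensorProduct.map f LinearMap.id : X ⊗[k] Y →ₗ[k] X ⊗[k] Y), lin_injective ?_⟩
  refine TensorProduct.ext' fun x y => ?_
  have hx : ∑ g, X.ρ g (f (X.ρ g⁻¹ x)) = x := by
    rw [← lin_average_apply, hf]; rfl
  calc _ = ∑ g, ((X.ρ g (f (X.ρ g⁻¹ x))) ⊗ₜ[k] (Y.ρ g (Y.ρ g⁻¹ y)) : X ⊗[k] Y) :=
        lin_average_apply _ _
    _ = x ⊗ₜ[k] y := by
        simp only [← Module.End.mul_apply, ← map_mul, mul_inv_cancel, map_one, Module.End.one_apply]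
        simp only [Module.End.mul_apply, ← TensorProduct.sum_tmul, hx]

lemma IsTraceOne.projective {X : FDRep k G} (hX : IsTraceOne X) : Projective X where
  factors {E Y} f e he := by
    obtain ⟨m, hm⟩ := hX
    obtain ⟨s, hs⟩ := (lin e).exists_rightInverse_of_surjective
      (LinearMap.range_eq_top.2 ((epi_iff e).1 he))
    refine ⟨average (s ∘ₗ lin f ∘ₗ m), ?_⟩
    rw [average_comp, ← LinearMap.comp_assoc, hs, LinearMap.id_comp, ← average_comp, hm,
      Category.id_comp]

lemma IsTraceOne.injective {X : FDRep k G} (hX : IsTraceOne X) : Injective X where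
  factors {Y E} f e he := by
    obtain ⟨m, hm⟩ := hX
    obtain ⟨s, hs⟩ := (lin e).exists_leftInverse_of_injective
      (LinearMap.ker_eq_bot.2 ((mono_iff e).1 he))
    refine ⟨average (m ∘ₗ lin f ∘ₗ s), ?_⟩
    rw [comp_average, LinearMap.comp_assoc, LinearMap.comp_assoc, hs, LinearMap.comp_id,
      ← comp_average, hm, Category.comp_id]

variable (k G) in
/-- The regular representation. -/
noncomputable abbrev regular : FDRep k G := FDRep.of (Representation.leftRegular k G)

variable (k G) in
/-- The counit `∑ a_g g ↦ ∑ a_g` of the group algebra. -/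
noncomputable def augmentation : regular k G →ₗ[k] k :=
  (MonoidAlgebra.basis G k).constr k fun _ => (1 : k)

variable (k G) in
/-- The projection of the group algebra onto the line spanned by `1`. -/
noncomputable def unitProj : regular k G →ₗ[k] regular k G :=
  ((MonoidAlgebra.basis G k).coord 1).smulRight (MonoidAlgebra.basis G k 1)

lemma augmentation_basis (g : G) : augmentation k G (MonoidAlgebra.basis G k g) = 1 :=
  (MonoidAlgebra.basis G k).constr_basis k _ g

lemma regular_ρ_basis (g h : G) : (regular k G).ρ g (MonoidAlgebra.basis G k h) =
    MonoidAlgebra.basis G k (g * h) :=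
  Representation.ofMulAction_single g h 1

lemma augmentation_ρ (g : G) (x : regular k G) :
    augmentation k G ((regular k G).ρ g x) = augmentation k G x := by
  have : augmentation k G ∘ₗ (regular k G).ρ g = augmentation k G :=
    (MonoidAlgebra.basis G k).ext fun h => by
      rw [LinearMap.comp_apply, regular_ρ_basis, augmentation_basis, augmentation_basis]
  exact LinearMap.congr_fun this x

variable (k G) in
lemma average_unitProj : average (unitProj k G) = 𝟙 (regular k G) := by
  classical
  refine lin_injective ((MonoidAlgebra.basis G k).ext fun h => ?_)
  refine (lin_average_apply _ _).trans ?_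
  have : ∀ g : G, (regular k G).ρ g (unitProj k G
      ((regular k G).ρ g⁻¹ (MonoidAlgebra.basis G k h))) =
      if g = h then MonoidAlgebra.basis G k h else 0 := fun g => by
    rw [regular_ρ_basis]
    have h1 : unitProj k G (MonoidAlgebra.basis G k (g⁻¹ * h)) =
      (if g = h then (1 : k) else 0) • MonoidAlgebra.basis G k 1 := by
      simp only [unitProj, LinearMap.smulRight_apply, Module.Basis.coord_apply,
        Module.Basis.repr_self, Finsupp.single_apply, inv_mul_eq_one]
    rw [h1, map_smul, regular_ρ_basis, mul_one]
    split_ifs with e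
    · rw [one_smul, e]
    · rw [zero_smul]
  rw [Finset.sum_congr rfl fun g _ => this g]
  simp only [Finset.sum_ite_eq', Finset.mem_univ, if_true]
  rfl

variable (k G) in
lemma isTraceOne_regular : IsTraceOne (regular k G) := ⟨unitProj k G, average_unitProj k G⟩

/-- The epimorphism `D ⊗ X ⟶ X` induced by the augmentation of the regular representation `D`. -/
noncomputable def regularTensorToSelf (X : FDRep k G) : regular k G ⊗ X ⟶ X :=
  homMk (TensorProduct.lid k X ∘ₗ TensorProduct.map (augmentation k G) LinearMap.id :
    regular k G ⊗[k] X →ₗ[k] X) (equivariant_of_tmul _ fun g a x => by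
      simp only [LinearMap.comp_apply, TensorProduct.map_tmul, TensorProduct.lid_tmul,
        LinearEquiv.coe_coe, map_smul, LinearMap.id_apply]
      exact congrArg (· • X.ρ g x) (augmentation_ρ g a))

lemma lin_regularTensorToSelf_tmul (X : FDRep k G) (a : regular k G) (x : X) :
    lin (regularTensorToSelf X) (a ⊗ₜ[k] x : regular k G ⊗[k] X) = augmentation k G a • x := rfl

lemma epi_regularTensorToSelf (X : FDRep k G) : Epi (regularTensorToSelf X) :=
  (epi_iff _).2 fun x => ⟨(MonoidAlgebra.basis G k 1 ⊗ₜ[k] x : regular k G ⊗[k] X), by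
    rw [lin_regularTensorToSelf_tmul, augmentation_basis, one_smul]⟩

/-- The monomorphism `X ⟶ D ⊗ X`, `x ↦ ∑ g, g ⊗ x`, into the tensor product with the regular
representation `D`. -/
noncomputable def selfToRegularTensor (X : FDRep k G) : X ⟶ regular k G ⊗ X :=
  average (Y := regular k G ⊗ X)
    (TensorProduct.mk k (regular k G) X (MonoidAlgebra.basis G k 1))

lemma lin_selfToRegularTensor (X : FDRep k G) (x : X) :
    lin (selfToRegularTensor X) x =
      (∑ g, (MonoidAlgebra.basis G k g) ⊗ₜ[k] x : regular k G ⊗[k] X) := by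
  refine (lin_average_apply _ _).trans (Finset.sum_congr rfl fun g _ => ?_)
  refine (tensor_ρ_tmul _ _ _ _ _).trans ?_
  rw [regular_ρ_basis, mul_one, ← Module.End.mul_apply, ← map_mul, mul_inv_cancel, map_one,
    Module.End.one_apply]

lemma mono_selfToRegularTensor (X : FDRep k G) : Mono (selfToRegularTensor X) := by
  classical
  refine (mono_iff _).2 (Function.LeftInverse.injective (g := (TensorProduct.lid k X ∘ₗ
    TensorProduct.map ((MonoidAlgebra.basis G k).coord 1) LinearMap.id :
    regular k G ⊗[k] X →ₗ[k] X)) fun x => ?_)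
  rw [lin_selfToRegularTensor, map_sum]
  simp only [LinearMap.comp_apply, TensorProduct.map_tmul, Module.Basis.coord_apply,
    Module.Basis.repr_self, Finsupp.single_apply, LinearMap.id_apply, LinearEquiv.coe_coe,
    TensorProduct.lid_tmul, ite_smul, one_smul, zero_smul, Finset.sum_ite_eq', Finset.mem_univ,
    if_true]

/-- Every object satisfying Higman's criterion is a retract of an induced one. -/
lemma IsTraceOne.retractRegular {X : FDRep k G} (hX : IsTraceOne X) :
    Nonempty (Retract X (regular k G ⊗ X)) := by
  have := hX.projective
  have := epi_regularTensorToSelf X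
  exact ⟨⟨Projective.factorThru (𝟙 X) (regularTensorToSelf X), regularTensorToSelf X,
    Projective.factorThru_comp _ _⟩⟩

lemma isTraceOne_of_projective {X : FDRep k G} (hX : Projective X) : IsTraceOne X := by
  have := epi_regularTensorToSelf X
  exact ((isTraceOne_regular k G).tensor X).retract
    ⟨Projective.factorThru (𝟙 X) (regularTensorToSelf X), regularTensorToSelf X,
      Projective.factorThru_comp _ _⟩

lemma isTraceOne_of_injective {X : FDRep k G} (hX : Injective X) : IsTraceOne X := by
  have := mono_selfToRegularTensor X
  exact ((isTraceOne_regular k G).tensor X).retract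
    ⟨selfToRegularTensor X, Injective.factorThru (𝟙 X) (selfToRegularTensor X),
      Injective.comp_factorThru _ _⟩

lemma projective_iff_isTraceOne {X : FDRep k G} : Projective X ↔ IsTraceOne X :=
  ⟨isTraceOne_of_projective, IsTraceOne.projective⟩

/-- A nonzero representation `X` has `D` as a retract of `X ⊗ D`: choose `x₀` and a functional `l`
with `l x₀ = 1`; then `g ↦ g x₀ ⊗ g` is split by `x ⊗ g ↦ l (g⁻¹ x) g`. -/
lemma retract_regular_tensor {X : FDRep k G} (hX : ¬ IsZero X) :
    Nonempty (Retract (regular k G) (X ⊗ regular k G)) := by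
  classical
  obtain ⟨x₀, hx₀⟩ : ∃ x₀ : X, x₀ ≠ 0 := by
    by_contra! h
    exact hX ((IsZero.iff_id_eq_zero X).2 (lin_injective (LinearMap.ext h)))
  obtain ⟨l, hl⟩ := Module.Projective.exists_dual_ne_zero k hx₀
  let m : X ⊗[k] regular k G →ₗ[k] regular k G :=
    TensorProduct.lid k (regular k G) ∘ₗ TensorProduct.map ((l x₀)⁻¹ • l) (unitProj k G)
  have hp : ∀ g : G, unitProj k G (MonoidAlgebra.basis G k g) =
      (if g = 1 then (1 : k) else 0) • MonoidAlgebra.basis G k 1 := fun g => by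
    simp only [unitProj, LinearMap.smulRight_apply, Module.Basis.coord_apply,
      Module.Basis.repr_self, Finsupp.single_apply]
  have hmt : ∀ x d, m (x ⊗ₜ[k] d) = ((l x₀)⁻¹ * l x) • unitProj k G d := fun _ _ => rfl
  have hm : lin (average (X := X ⊗ regular k G) m)
      (x₀ ⊗ₜ[k] MonoidAlgebra.basis G k 1 : X ⊗[k] regular k G) = MonoidAlgebra.basis G k 1 := by
    refine (lin_average_apply _ _).trans ?_
    refine (Finset.sum_eq_single 1 (fun g _ hg => ?_) (by simp)).trans ?_
    · rw [tensor_ρ_tmul, hmt, regular_ρ_basis, hp, if_neg (by simpa using hg), zero_smul,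
        smul_zero, map_zero]
    · rw [tensor_ρ_tmul, hmt, regular_ρ_basis, hp, if_pos (by simp), one_smul, inv_one, map_one,
        map_one, Module.End.one_apply, Module.End.one_apply, inv_mul_cancel₀ hl, one_smul]
  refine ⟨⟨average (Y := X ⊗ regular k G) (TensorProduct.mk k X (regular k G) x₀ ∘ₗ unitProj k G),
    average (X := X ⊗ regular k G) m, ?_⟩⟩
  rw [average_comp, ← average_unitProj]
  congr 1
  refine (MonoidAlgebra.basis G k).ext fun g => ?_
  have : lin (average (X := X ⊗ regular k G) m)
      (x₀ ⊗ₜ[k] unitProj k G (MonoidAlgebra.basis G k g) : X ⊗[k] regular k G) =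
      unitProj k G (MonoidAlgebra.basis G k g) := by
    rw [hp, TensorProduct.tmul_smul]
    exact (map_smul _ _ _).trans (congrArg _ hm)
  exact this

end FDRep

/-! ### Tensor ideals and short exact sequences -/

section Ideals

variable {C : Type*} [Category C] [MonoidalCategory C]

lemma isTensorIdeal_idealOf (V : C) : IsTensorIdeal (idealOf V) where
  tensor := by
    rintro U W ⟨X, ⟨r⟩⟩
    exact ⟨X ⊗ W, ⟨(r.map (tensorRight W)).trans (.ofIso (α_ V X W))⟩⟩
  retract := by
    rintro U W ⟨X, ⟨r⟩⟩ ⟨s⟩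
    exact ⟨X, ⟨s.trans r⟩⟩

lemma idealOf_self (V : C) : idealOf V V := ⟨𝟙_ C, ⟨.ofIso (ρ_ V).symm⟩⟩

lemma IsTensorIdeal.idealOf_le {I : ObjectProperty C} (hI : IsTensorIdeal I) {V : C} (hV : I V) :
    idealOf V ≤ I := by
  rintro U ⟨W, hW⟩
  exact hI.retract _ _ (hI.tensor V W hV) hW

lemma idealOf_le_iff {V W : C} : idealOf V ≤ idealOf W ↔ idealOf W V :=
  ⟨fun h => h _ (idealOf_self V), (isTensorIdeal_idealOf W).idealOf_le⟩

lemma idealOf_unit : idealOf (𝟙_ C) = ⊤ :=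
  top_le_iff.1 fun X _ => ⟨X, ⟨.ofIso (λ_ X).symm⟩⟩

/-- Ideals contain an object whose identity is a sum of two maps factoring through objects of the
form `V ⊗ W`. -/
lemma idealOf_of_add_eq_id [Preadditive C] [MonoidalPreadditive C] [HasBinaryBiproducts C]
    {U V W₁ W₂ : C} (i : U ⟶ V ⊗ W₁) (p : V ⊗ W₁ ⟶ U) (j : U ⟶ V ⊗ W₂) (q : V ⊗ W₂ ⟶ U)
    (h : i ≫ p + j ≫ q = 𝟙 U) : idealOf V U := by
  refine ⟨W₁ ⊞ W₂, ⟨⟨i ≫ V ◁ biprod.inl + j ≫ V ◁ biprod.inr,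
    V ◁ biprod.fst ≫ p + V ◁ biprod.snd ≫ q, ?_⟩⟩⟩
  simp [← whiskerLeft_comp_assoc, h]

end Ideals

section Schanuel

variable {C : Type*} [Category C] [Abelian C]

/-- Schanuel's lemma for cokernels of embeddings into injectives, as a statement modulo maps that
factor through the injective `S.X₂`. -/
lemma exists_comparison_X₃ {S T : ShortComplex C} (hS : S.ShortExact) (hT : T.ShortExact)
    (e : S.X₁ ≅ T.X₁) [Injective S.X₂] [Injective T.X₂] :
    ∃ (u : S.X₃ ⟶ T.X₃) (v : T.X₃ ⟶ S.X₃) (t : S.X₃ ⟶ S.X₂), 𝟙 S.X₃ - u ≫ v = t ≫ S.g := by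
  have := hS.mono_f
  have := hS.epi_g
  have := hT.mono_f
  have := hT.epi_g
  let a : S.X₂ ⟶ T.X₂ := Injective.factorThru (e.hom ≫ T.f) S.f
  let b : T.X₂ ⟶ S.X₂ := Injective.factorThru (e.inv ≫ S.f) T.f
  have ha : S.f ≫ a = e.hom ≫ T.f := Injective.comp_factorThru _ _
  have hb : T.f ≫ b = e.inv ≫ S.f := Injective.comp_factorThru _ _
  let u := hS.exact.desc (a ≫ T.g) (by simp [reassoc_of% ha])
  let v := hT.exact.desc (b ≫ S.g) (by simp [reassoc_of% hb])
  let t := hS.exact.desc (𝟙 _ - a ≫ b) (by simp [reassoc_of% ha, hb])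
  have hu : S.g ≫ u = a ≫ T.g := hS.exact.g_desc _ _
  have hv : T.g ≫ v = b ≫ S.g := hT.exact.g_desc _ _
  have ht : S.g ≫ t = 𝟙 _ - a ≫ b := hS.exact.g_desc _ _
  refine ⟨u, v, t, ?_⟩
  rw [← cancel_epi S.g]
  simp [reassoc_of% hu, hv, reassoc_of% ht]

/-- Schanuel's lemma for kernels of covers by projectives, as a statement modulo maps that
factor through the projective `S.X₂`. -/
lemma exists_comparison_X₁ {S T : ShortComplex C} (hS : S.ShortExact) (hT : T.ShortExact)
    (e : S.X₃ ≅ T.X₃) [Projective S.X₂] [Projective T.X₂] :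
    ∃ (u : S.X₁ ⟶ T.X₁) (v : T.X₁ ⟶ S.X₁) (t : S.X₂ ⟶ S.X₁), 𝟙 S.X₁ - u ≫ v = S.f ≫ t := by
  have := hS.mono_f
  have := hS.epi_g
  have := hT.mono_f
  have := hT.epi_g
  let a : S.X₂ ⟶ T.X₂ := Projective.factorThru (S.g ≫ e.hom) T.g
  let b : T.X₂ ⟶ S.X₂ := Projective.factorThru (T.g ≫ e.inv) S.g
  have ha : a ≫ T.g = S.g ≫ e.hom := Projective.factorThru_comp _ _
  have hb : b ≫ S.g = T.g ≫ e.inv := Projective.factorThru_comp _ _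
  let u := hT.exact.lift (S.f ≫ a) (by simp [ha])
  let v := hS.exact.lift (T.f ≫ b) (by simp [hb])
  let t := hS.exact.lift (𝟙 _ - a ≫ b) (by simp [hb, reassoc_of% ha])
  have hu : u ≫ T.f = S.f ≫ a := hT.exact.lift_f _ _
  have hv : v ≫ S.f = T.f ≫ b := hS.exact.lift_f _ _
  have ht : t ≫ S.f = 𝟙 _ - a ≫ b := hS.exact.lift_f _ _
  refine ⟨u, v, t, ?_⟩
  rw [← cancel_mono S.f]
  simp [hv, reassoc_of% hu, ht]

end Schanuel

namespace FDRep

variable {k : Type u} [Field k] {G : Type} [Group G] [Fintype G]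

lemma projective_le_ideal {I : ObjectProperty (FDRep k G)} (hI : IsTensorIdeal I)
    {X : FDRep k G} (hX : I X) (h0 : ¬ IsZero X) : isProjective (FDRep k G) ≤ I := by
  intro P hP
  have hD : I (regular k G) := hI.retract _ _ (hI.tensor X _ hX) (retract_regular_tensor h0)
  exact hI.retract _ _ (hI.tensor _ P hD) (isTraceOne_of_projective hP).retractRegular

variable (k G) in
lemma isProjective_eq_idealOf_regular : isProjective (FDRep k G) = idealOf (regular k G) := by
  refine le_antisymm (fun P hP => ⟨P, (isTraceOne_of_projective hP).retractRegular⟩) ?_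
  rintro P ⟨W, ⟨r⟩⟩
  exact (((isTraceOne_regular k G).tensor W).retract r).projective

/-- Modulo projectives, being a retract of `V ⊗ W` is enough for lying in the ideal of `V`. -/
lemma idealOf_of_sub_factors {U V W P : FDRep k G} (h0 : ¬ IsZero V) (hP : Projective P)
    (i : U ⟶ V ⊗ W) (p : V ⊗ W ⟶ U) (j : U ⟶ P) (q : P ⟶ U) (h : 𝟙 U - i ≫ p = j ≫ q) :
    idealOf V U := by
  obtain ⟨W', ⟨r⟩⟩ := projective_le_ideal (isTensorIdeal_idealOf V) (idealOf_self V) h0 P hP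
  refine idealOf_of_add_eq_id i p (j ≫ r.i) (r.r ≫ q) ?_
  simp [← h]

instance (X : FDRep k G) : PreservesFiniteLimits (tensorLeft X) := by
  have := (tensorLeftAdjunction X Xᘁ).rightAdjoint_preservesLimits
  infer_instance

instance (X : FDRep k G) : PreservesFiniteColimits (tensorLeft X) := by
  have := (tensorRightAdjunction X Xᘁ).leftAdjoint_preservesColimits
  have : PreservesFiniteColimits (tensorRight X) := inferInstance
  exact preservesFiniteColimits_of_natIso (BraidedCategory.tensorLeftIsoTensorRight X).symm

/-- In a short exact sequence with projective middle term, the right term lies in the ideal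
generated by the left term `X`: it agrees modulo projectives with the cokernel `X ⊗ (D / k)` of
`X ⊗ k ⟶ X ⊗ D`. -/
lemma idealOf_X₁_X₃ {S : ShortComplex (FDRep k G)} (hS : S.ShortExact)
    (hP : Projective S.X₂) (h0 : ¬ IsZero S.X₁) : idealOf S.X₁ S.X₃ := by
  have := (projective_iff_isTraceOne.1 hP).injective
  let ν : 𝟙_ (FDRep k G) ⟶ regular k G := selfToRegularTensor _ ≫ (ρ_ _).hom
  have hν : Mono ν := by
    have := mono_selfToRegularTensor (𝟙_ (FDRep k G))
    exact mono_comp _ _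
  let T : ShortComplex (FDRep k G) := ShortComplex.mk ν (cokernel.π ν) (by simp)
  have hT : T.ShortExact :=
    { exact := ShortComplex.exact_of_g_is_cokernel _ (cokernelIsCokernel ν)
      mono_f := hν
      epi_g := inferInstanceAs (Epi (cokernel.π ν)) }
  have : Injective (T.map (tensorLeft S.X₁)).X₂ :=
    (((isTraceOne_regular k G).tensor S.X₁).retract (.ofIso (β_ _ _))).injective
  obtain ⟨u, v, t, h⟩ := exists_comparison_X₃ hS (hT.map_of_exact (tensorLeft S.X₁)) (ρ_ _).symm
  exact idealOf_of_sub_factors h0 hP u v t S.g h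

/-- In a short exact sequence with projective middle term, the left term lies in the ideal
generated by the right term `X`: it agrees modulo projectives with the kernel of
`X ⊗ D ⟶ X ⊗ k`. -/
lemma idealOf_X₃_X₁ {S : ShortComplex (FDRep k G)} (hS : S.ShortExact)
    (hP : Projective S.X₂) (h0 : ¬ IsZero S.X₃) : idealOf S.X₃ S.X₁ := by
  let ε : regular k G ⟶ 𝟙_ (FDRep k G) := (ρ_ _).inv ≫ regularTensorToSelf _
  have hε : Epi ε := by
    have := epi_regularTensorToSelf (𝟙_ (FDRep k G))
    exact epi_comp _ _
  let T : ShortComplex (FDRep k G) := ShortComplex.mk (kernel.ι ε) ε (by simp)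
  have hT : T.ShortExact :=
    { exact := ShortComplex.exact_of_f_is_kernel _ (kernelIsKernel ε)
      mono_f := inferInstanceAs (Mono (kernel.ι ε))
      epi_g := hε }
  have : Projective (T.map (tensorLeft S.X₃)).X₂ :=
    (((isTraceOne_regular k G).tensor S.X₃).retract (.ofIso (β_ _ _))).projective
  obtain ⟨u, v, t, h⟩ := exists_comparison_X₁ hS (hT.map_of_exact (tensorLeft S.X₃)) (ρ_ _).symm
  exact idealOf_of_sub_factors h0 hP u v S.f t h

lemma projective_X₁_iff_X₃ {S : ShortComplex (FDRep k G)} (hS : S.ShortExact)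
    (hP : Projective S.X₂) : Projective S.X₁ ↔ Projective S.X₃ := by
  have := hS.mono_f
  have := hS.epi_g
  constructor
  · intro h
    have := (projective_iff_isTraceOne.1 h).injective
    let σ := hS.splittingOfInjective
    exact (Retract.mk σ.s S.g σ.s_g).projective
  · intro h
    let σ := hS.splittingOfProjective
    exact (Retract.mk S.f σ.r σ.f_r).projective

/-- The two ends of a short exact sequence with projective middle term generate the same ideal,
unless they are projective. -/
lemma idealOf_X₁_eq_X₃ {S : ShortComplex (FDRep k G)} (hS : S.ShortExact)
    (hP : Projective S.X₂) (h : ¬ Projective S.X₁) : idealOf S.X₁ = idealOf S.X₃ := by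
  refine le_antisymm (idealOf_le_iff.2 (idealOf_X₃_X₁ hS hP fun h0 => h ?_))
    (idealOf_le_iff.2 (idealOf_X₁_X₃ hS hP fun h0 => h h0.projective))
  exact (projective_X₁_iff_X₃ hS hP).2 h0.projective

end FDRep

/-! ### Projective covers, injective hulls and Heller shifts -/

namespace FDRep

section Fitting

variable {k : Type u} [Field k] {G : Type} [Group G]

lemma isIso_of_mono_endo {X : FDRep k G} (f : X ⟶ X) [Mono f] : IsIso f := by
  have : Epi f := (epi_iff f).2 (LinearMap.injective_iff_surjective.1 ((mono_iff f).1 inferInstance))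
  exact isIso_of_mono_of_epi f

/-- Fitting's lemma: an endomorphism `φ` which is not invertible has a power that factors through
a proper retract of its source. The retract is `P'`, with the inclusion `j` and, up to the
automorphism `j ≫ s`, the projection `s`. -/
lemma exists_fitting {P : FDRep k G} (φ : End P) (hφ : ¬ IsIso φ) :
    ∃ (P' : FDRep k G) (s : P ⟶ P') (j : P' ⟶ P), IsIso (j ≫ s) ∧
      (∃ n : ℕ, s ≫ j = φ ^ n) ∧ Module.finrank k P' < Module.finrank k P := by
  -- a positive exponent, so that `φ` itself is surjective once `φ ^ n` is
  obtain ⟨n, hn, hn0⟩ := ((Module.End.eventually_disjoint_ker_pow_range_pow (lin φ)).and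
    (Filter.eventually_ge_atTop 1)).exists
  have hpow : ∀ n : ℕ, lin (φ ^ n) = lin φ ^ n := by
    intro n
    induction n with
    | zero => rfl
    | succ n ih =>
      rw [pow_succ, pow_succ, ← ih]
      rfl
  let ψ : P ⟶ P := φ ^ n
  have hfac : Abelian.factorThruImage ψ ≫ Abelian.image.ι ψ = ψ := Abelian.image.fac ψ
  let s := Abelian.factorThruImage ψ
  let j := Abelian.image.ι ψ
  have hs : Function.Surjective (lin s) := (epi_iff s).1 inferInstance
  have hj : Function.Injective (lin j) := (mono_iff j).1 inferInstance
  have hsj : ∀ x, lin j (lin s x) = (lin φ ^ n) x := fun x => by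
    rw [← hpow]; exact LinearMap.congr_fun (congrArg lin hfac) x
  -- the image of `φ ^ n` meets its kernel trivially
  have hmono : Mono (j ≫ s) := by
    rw [mono_iff, ← LinearMap.ker_eq_bot, LinearMap.ker_eq_bot']
    intro x hx
    obtain ⟨y, rfl⟩ := hs x
    have h1 : lin j (lin s y) ∈ LinearMap.ker (lin φ ^ n) := by
      rw [LinearMap.mem_ker, ← hsj]
      exact (congrArg (lin j) hx).trans (map_zero _)
    have h2 : lin j (lin s y) ∈ LinearMap.range (lin φ ^ n) := ⟨y, (hsj y).symm⟩
    exact hj ((Submodule.disjoint_def.1 hn _ h1 h2).trans (map_zero _).symm)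
  refine ⟨_, s, j, isIso_of_mono_endo _, ⟨n, hfac⟩, ?_⟩
  refine lt_of_le_of_ne (LinearMap.finrank_le_finrank_of_injective hj) fun h => hφ ?_
  have hj' : Function.Surjective (lin j) :=
    (LinearMap.injective_iff_surjective_of_finrank_eq_finrank h).1 hj
  have : Epi φ := by
    rw [epi_iff]
    intro y
    obtain ⟨x, rfl⟩ := hj' y
    obtain ⟨z, rfl⟩ := hs x
    obtain ⟨m, rfl⟩ := Nat.exists_eq_succ_of_ne_zero (Nat.one_le_iff_ne_zero.1 hn0)
    exact ⟨(lin φ ^ m) z, by rw [hsj, pow_succ']; rfl⟩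
  have : Mono φ :=
    (mono_iff φ).2 (LinearMap.injective_iff_surjective.2 ((epi_iff φ).1 inferInstance))
  exact isIso_of_mono_of_epi φ

end Fitting

variable {k : Type u} [Field k] {G : Type} [Group G] [Fintype G]

omit [Fintype G] in
lemma exists_min_finrank {p : FDRep k G → Prop} (h : ∃ X, p X) :
    ∃ X, p X ∧ ∀ Y, p Y → Module.finrank k X ≤ Module.finrank k Y := by
  obtain ⟨X, hX⟩ := h
  obtain ⟨Y, hY, hmin⟩ := WellFounded.has_min
    (measure fun X : FDRep k G => Module.finrank k X).wf {X | p X} ⟨X, hX⟩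
  exact ⟨Y, hY, fun Z hZ => not_lt.1 (hmin Z hZ)⟩

/-- A cover of `N` by a projective module of least possible dimension is a projective cover. -/
lemma exists_isProjectiveCover (N : FDRep k G) :
    ∃ (P : FDRep k G) (p : P ⟶ N), IsProjectiveCover p := by
  obtain ⟨P, ⟨hP, p, hp⟩, hmin⟩ := exists_min_finrank
    (p := fun P : FDRep k G => Projective P ∧ ∃ p : P ⟶ N, Epi p)
    ⟨_, ((isTraceOne_regular k G).tensor N).projective, _, epi_regularTensorToSelf N⟩
  refine ⟨P, p, hP, hp, fun {Q} f hf => ?_⟩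
  -- `l ≫ f` is an endomorphism over `N`; unless it is invertible, a smaller retract covers `N`
  let l := Projective.factorThru p (f ≫ p)
  have hl : (l ≫ f) ≫ p = p := by
    rw [Category.assoc]; exact Projective.factorThru_comp _ _
  by_cases hiso : IsIso (l ≫ f)
  · exact epi_of_epi l f
  obtain ⟨P', s, j, hjs, ⟨n, hn⟩, hlt⟩ := exists_fitting _ hiso
  have hpow : (s ≫ j) ≫ p = p := by
    rw [hn]
    clear hn
    induction n with
    | zero => exact Category.id_comp p
    | succ n ih =>
      rw [pow_succ', End.mul_def, Category.assoc]
      erw [hl]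
      exact ih
  refine absurd (hmin P' ⟨(Retract.mk j (s ≫ inv (j ≫ s)) (by simp [← Category.assoc])).projective,
    j ≫ p, ?_⟩) (not_le.2 hlt)
  rw [Category.assoc] at hpow
  have : Epi (s ≫ j ≫ p) := by rwa [hpow]
  exact epi_of_epi s _

/-- An embedding of `M` into an injective module of least possible dimension is an injective
hull. -/
lemma exists_isInjectiveHull (M : FDRep k G) :
    ∃ (E : FDRep k G) (i : M ⟶ E), IsInjectiveHull i := by
  obtain ⟨E, ⟨hE, i, hi⟩, hmin⟩ := exists_min_finrank
    (p := fun E : FDRep k G => Injective E ∧ ∃ i : M ⟶ E, Mono i)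
    ⟨_, ((isTraceOne_regular k G).tensor M).injective, _, mono_selfToRegularTensor M⟩
  refine ⟨E, i, hE, hi, fun {Q} f hf => ?_⟩
  -- `f ≫ l` is an endomorphism under `M`; unless it is invertible, `M` embeds into a smaller
  -- retract
  let l := Injective.factorThru i (i ≫ f)
  have hl : i ≫ (f ≫ l) = i := by
    rw [← Category.assoc]; exact Injective.comp_factorThru _ _
  by_cases hiso : IsIso (f ≫ l)
  · exact mono_of_mono f l
  obtain ⟨E', s, j, hjs, ⟨n, hn⟩, hlt⟩ := exists_fitting _ hiso
  have hpow : i ≫ (s ≫ j) = i := by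
    rw [hn]
    clear hn
    induction n with
    | zero => exact Category.comp_id i
    | succ n ih =>
      rw [pow_succ, End.mul_def, ← Category.assoc]
      erw [hl]
      exact ih
  refine absurd (hmin E' ⟨?_, i ≫ s, ?_⟩) (not_le.2 hlt)
  · exact ((isTraceOne_of_injective hE).retract
      ⟨j, s ≫ inv (j ≫ s), by simp [← Category.assoc]⟩).injective
  · rw [← Category.assoc] at hpow
    have : Mono ((i ≫ s) ≫ j) := by rwa [hpow]
    exact mono_of_mono _ j

lemma exists_isOmega (N : FDRep k G) : ∃ M, IsOmega M N := by
  obtain ⟨P, p, hp⟩ := exists_isProjectiveCover N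
  exact ⟨kernel p, P, p, kernel.ι p, kernel.condition p, hp, ⟨kernelIsKernel p⟩⟩

lemma exists_isOmegaInv (N : FDRep k G) : ∃ M, IsOmegaInv M N := by
  obtain ⟨E, i, hi⟩ := exists_isInjectiveHull N
  exact ⟨cokernel i, E, i, cokernel.π i, cokernel.condition i, hi, ⟨cokernelIsCokernel i⟩⟩

/-- `Ω` preserves the generated ideal of a nonprojective object. -/
lemma IsOmega.idealOf_eq {M N : FDRep k G} (h : IsOmega M N) (hN : ¬ Projective N) :
    ¬ Projective M ∧ idealOf M = idealOf N := by
  obtain ⟨P, p, i, w, hp, ⟨hi⟩⟩ := h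
  have := hp.epi
  have hS : (ShortComplex.mk i p w).ShortExact :=
    { exact := ShortComplex.exact_of_f_is_kernel _ hi
      mono_f := mono_of_isLimit_fork hi
      epi_g := hp.epi }
  have hM : ¬ Projective M := fun h => hN ((projective_X₁_iff_X₃ hS hp.projective).1 h)
  exact ⟨hM, idealOf_X₁_eq_X₃ hS hp.projective hM⟩

/-- `Ω⁻¹` preserves the generated ideal of a nonprojective object. -/
lemma IsOmegaInv.idealOf_eq {M N : FDRep k G} (h : IsOmegaInv M N) (hN : ¬ Projective N) :
    ¬ Projective M ∧ idealOf M = idealOf N := by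
  obtain ⟨E, i, p, w, hi, ⟨hp⟩⟩ := h
  have hE : Projective E := (isTraceOne_of_injective hi.injective).projective
  have hS : (ShortComplex.mk i p w).ShortExact :=
    { exact := ShortComplex.exact_of_g_is_cokernel _ hp
      mono_f := hi.mono
      epi_g := epi_of_isColimit_cofork hp }
  exact ⟨fun h => hN ((projective_X₁_iff_X₃ hS hE).2 h), (idealOf_X₁_eq_X₃ hS hE hN).symm⟩

omit [Fintype G] in
lemma exists_iterShift {R : FDRep k G → FDRep k G → Prop} (hR : ∀ N, ∃ M, R M N) (N : FDRep k G) :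
    ∀ n : ℕ, ∃ M, IterShift R n M N
  | 0 => ⟨N, ⟨Iso.refl N⟩⟩
  | n + 1 => by
    obtain ⟨L, hL⟩ := exists_iterShift hR N n
    obtain ⟨M, hM⟩ := hR L
    exact ⟨M, L, hM, hL⟩

omit [Fintype G] in
lemma iterShift_idealOf_eq {R : FDRep k G → FDRep k G → Prop}
    (hR : ∀ M N, R M N → ¬ Projective N → ¬ Projective M ∧ idealOf M = idealOf N)
    {N : FDRep k G} (hN : ¬ Projective N) :
    ∀ (n : ℕ) (M : FDRep k G), IterShift R n M N → ¬ Projective M ∧ idealOf M = idealOf N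
  | 0, M, ⟨e⟩ => ⟨fun h => hN (Projective.of_iso e h), le_antisymm
      (idealOf_le_iff.2 ((isTensorIdeal_idealOf N).retract _ _ (idealOf_self N) ⟨.ofIso e⟩))
      (idealOf_le_iff.2 ((isTensorIdeal_idealOf M).retract _ _ (idealOf_self M) ⟨.ofIso e.symm⟩))⟩
  | n + 1, M, ⟨L, hML, hLN⟩ => by
    obtain ⟨hL, e⟩ := iterShift_idealOf_eq hR hN n L hLN
    obtain ⟨hM, e'⟩ := hR M L hML hL
    exact ⟨hM, e'.trans e⟩

lemma exists_isHellerShift (n : ℤ) (N : FDRep k G) : ∃ M, IsHellerShift n M N :=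
  match n with
  | Int.ofNat n => exists_iterShift exists_isOmega N n
  | Int.negSucc n => exists_iterShift exists_isOmegaInv N (n + 1)

/-- All Heller shifts of a nonprojective object generate the same ideal. -/
lemma idealOf_isHellerShift {n : ℤ} {M N : FDRep k G} (hN : ¬ Projective N)
    (h : IsHellerShift n M N) : idealOf M = idealOf N :=
  match n, h with
  | Int.ofNat n, h => (iterShift_idealOf_eq (fun _ _ => IsOmega.idealOf_eq) hN n M h).2
  | Int.negSucc n, h => (iterShift_idealOf_eq (fun _ _ => IsOmegaInv.idealOf_eq) hN (n + 1) M h).2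

end FDRep

/-! ### Slope operators for the Klein four group -/

lemma V4.mul_self (x : V4) : x * x = 1 := by revert x; decide

namespace FDRep

variable {k : Type u} [Field k]

lemma ρ_mul_apply (X : FDRep k V4) (x y : V4) (v : X) : X.ρ (x * y) v = X.ρ x (X.ρ y v) := by
  rw [map_mul, Module.End.mul_apply]

lemma ρ_ρ_self (X : FDRep k V4) (x : V4) (v : X) : X.ρ x (X.ρ x v) = v := by
  rw [← ρ_mul_apply, V4.mul_self, map_one, Module.End.one_apply]

lemma ρ_comm (X : FDRep k V4) (x y : V4) (v : X) : X.ρ x (X.ρ y v) = X.ρ y (X.ρ x v) := by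
  rw [← ρ_mul_apply, mul_comm, ρ_mul_apply]

lemma add_self_eq_zero [CharP k 2] {M : Type*} [AddCommGroup M] [Module k M] (v : M) :
    v + v = 0 := by
  rw [← two_smul k, CharTwo.two_eq_zero, zero_smul]

/-- The operator `(1 + a) (1 + b)` on a representation of the Klein four group; if `a` and `b`
generate the group, it is the norm. -/
noncomputable def norm (a b : V4) (X : FDRep k V4) : X →ₗ[k] X :=
  LinearMap.id + X.ρ a + X.ρ b + X.ρ a ∘ₗ X.ρ b

/-- The sum of the conjugates of `m` under `1`, `a`, `b` and `a b`. -/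
noncomputable def conjSum (a b : V4) (X : FDRep k V4) (m : X →ₗ[k] X) : X →ₗ[k] X :=
  m + X.ρ a ∘ₗ m ∘ₗ X.ρ a + X.ρ b ∘ₗ m ∘ₗ X.ρ b +
    X.ρ a ∘ₗ X.ρ b ∘ₗ m ∘ₗ X.ρ b ∘ₗ X.ρ a

/-- A slope pair: an operator `c` with `c - a c a⁻¹ = 1`, which exhibits `X` as free over `⟨a⟩`, and
the operator `τ = c - b c b⁻¹`, an endomorphism of `X`. -/
structure IsSlopePair (a b : V4) (X : FDRep k V4) (c τ : X →ₗ[k] X) : Prop where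
  c_a : c ∘ₗ X.ρ a = X.ρ a + X.ρ a ∘ₗ c
  c_b : c ∘ₗ X.ρ b = X.ρ b ∘ₗ τ + X.ρ b ∘ₗ c
  τ_a : τ ∘ₗ X.ρ a = X.ρ a ∘ₗ τ
  τ_b : τ ∘ₗ X.ρ b = X.ρ b ∘ₗ τ

lemma IsSlopePair.tensor {a b : V4} {X : FDRep k V4} {c τ : X →ₗ[k] X} (h : IsSlopePair a b X c τ)
    (Y : FDRep k V4) : IsSlopePair a b (X ⊗ Y)
      (TensorProduct.map c LinearMap.id : X ⊗[k] Y →ₗ[k] X ⊗[k] Y)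
      (TensorProduct.map τ LinearMap.id : X ⊗[k] Y →ₗ[k] X ⊗[k] Y) := by
  let C : X ⊗[k] Y →ₗ[k] X ⊗[k] Y := TensorProduct.map c LinearMap.id
  let τ' : X ⊗[k] Y →ₗ[k] X ⊗[k] Y := TensorProduct.map τ LinearMap.id
  let r (g : V4) : X ⊗[k] Y →ₗ[k] X ⊗[k] Y := TensorProduct.map (X.ρ g) (Y.ρ g)
  have h1 : C ∘ₗ r a = r a + r a ∘ₗ C := by
    simp only [C, r, ← TensorProduct.map_comp, LinearMap.comp_id, LinearMap.id_comp,
      ← TensorProduct.map_add_left, h.c_a]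
  have h2 : C ∘ₗ r b = r b ∘ₗ τ' + r b ∘ₗ C := by
    simp only [C, τ', r, ← TensorProduct.map_comp, LinearMap.comp_id, LinearMap.id_comp,
      ← TensorProduct.map_add_left, h.c_b]
  have h3 : τ' ∘ₗ r a = r a ∘ₗ τ' := by
    simp only [τ', r, ← TensorProduct.map_comp, LinearMap.comp_id, LinearMap.id_comp, h.τ_a]
  have h4 : τ' ∘ₗ r b = r b ∘ₗ τ' := by
    simp only [τ', r, ← TensorProduct.map_comp, LinearMap.comp_id, LinearMap.id_comp, h.τ_b]
  exact ⟨h1, h2, h3, h4⟩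

lemma conjSum_tensor (a b : V4) (X Y : FDRep k V4) (m : X →ₗ[k] X) :
    conjSum a b (X ⊗ Y) (TensorProduct.map m LinearMap.id : X ⊗[k] Y →ₗ[k] X ⊗[k] Y) =
      (TensorProduct.map (conjSum a b X m) LinearMap.id : X ⊗[k] Y →ₗ[k] X ⊗[k] Y) := by
  refine TensorProduct.ext' fun x y => ?_
  have h : conjSum a b (X ⊗ Y) (TensorProduct.map m LinearMap.id : X ⊗[k] Y →ₗ[k] X ⊗[k] Y)
      (x ⊗ₜ[k] y : X ⊗[k] Y) = (m x ⊗ₜ[k] y + X.ρ a (m (X.ρ a x)) ⊗ₜ[k] Y.ρ a (Y.ρ a y) +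
        X.ρ b (m (X.ρ b x)) ⊗ₜ[k] Y.ρ b (Y.ρ b y) +
        X.ρ a (X.ρ b (m (X.ρ b (X.ρ a x)))) ⊗ₜ[k] Y.ρ a (Y.ρ b (Y.ρ b (Y.ρ a y))) :
        X ⊗[k] Y) := rfl
  rw [h]
  simp only [ρ_ρ_self, ← TensorProduct.add_tmul]
  rfl

/-- On the Tate cohomology group `X^G / norm`, multiplication by the quotient of the classes of `b`
and `a` is the relation `v ↦ w` for which there is `u` with `(a - 1) u = v` and `(b - 1) u = w`. The
predicate says that `X` is free over `⟨a⟩`, at least as far as invariants can see, and that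
the `N`-th iterate of this relation, shifted by the scalar `β`, is zero. It is formulated with
chains of vectors so that it passes to retracts. -/
structure SlopeBounded (a b : V4) (β : k) (N : ℕ) (X : FDRep k V4) : Prop where
  lift : ∀ v, X.ρ a v = v → ∃ u, X.ρ a u = u + v
  chain : ∀ v u : ℕ → X, (∀ i, X.ρ a (v i) = v i) → (∀ i, X.ρ b (v i) = v i) →
    (∀ i, X.ρ a (u i) = u i + v i) → (∀ i, X.ρ b (u i) = u i + (β • v i + v (i + 1))) →
    ∃ z, v N = norm a b X z

lemma lin_norm {X Y : FDRep k V4} (f : X ⟶ Y) (a b : V4) (x : X) :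
    lin f (norm a b X x) = norm a b Y (lin f x) := by
  simp [norm, lin_ρ]

lemma SlopeBounded.retract {a b : V4} {β : k} {N : ℕ} {X Y : FDRep k V4}
    (h : SlopeBounded a b β N X) (r : Retract Y X) : SlopeBounded a b β N Y := by
  have hr : ∀ y, lin r.r (lin r.i y) = y := fun y =>
    LinearMap.congr_fun (congrArg lin r.retract) y
  constructor
  · intro v hv
    obtain ⟨u, hu⟩ := h.lift (lin r.i v) (by rw [← lin_ρ, hv])
    exact ⟨lin r.r u, by rw [← lin_ρ, hu, map_add, hr]⟩
  · intro v u h1 h2 h3 h4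
    obtain ⟨z, hz⟩ := h.chain (fun i => lin r.i (v i)) (fun i => lin r.i (u i))
      (fun i => by rw [← lin_ρ, h1]) (fun i => by rw [← lin_ρ, h2])
      (fun i => by rw [← lin_ρ, h3, map_add])
      (fun i => by rw [← lin_ρ, h4, map_add, map_add, map_smul])
    exact ⟨lin r.r z, by rw [← lin_norm, ← hz, hr]⟩

/-- On invariants, modulo norms, the relation in `SlopeBounded` is the map `τ - β`; its `N`-th power
is a norm if `(τ - β) ^ N` is a relative trace. -/
lemma IsSlopePair.slopeBounded [CharP k 2] {a b : V4} {X : FDRep k V4} {c τ : X →ₗ[k] X}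
    (h : IsSlopePair a b X c τ) {β : k} {N : ℕ} (m : X →ₗ[k] X)
    (hm : ((τ + β • LinearMap.id : Module.End k X) ^ N : Module.End k X) = conjSum a b X m) :
    SlopeBounded a b β N X := by
  have two := add_self_eq_zero (k := k) (M := X)
  have c_a : ∀ v, c (X.ρ a v) = X.ρ a v + X.ρ a (c v) := fun v => LinearMap.congr_fun h.c_a v
  have c_b : ∀ v, c (X.ρ b v) = X.ρ b (τ v) + X.ρ b (c v) := fun v => LinearMap.congr_fun h.c_b v
  have τ_a : ∀ v, τ (X.ρ a v) = X.ρ a (τ v) := fun v => LinearMap.congr_fun h.τ_a v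
  have τ_b : ∀ v, τ (X.ρ b v) = X.ρ b (τ v) := fun v => LinearMap.congr_fun h.τ_b v
  -- all signs below are absorbed by the characteristic
  have lift : ∀ v, X.ρ a v = v → X.ρ a (c v) = c v + v := fun v hv => by
    have := c_a v
    rw [hv] at this
    linear_combination (norm := module) - two v - this
  refine ⟨fun v hv => ⟨c v, lift v hv⟩, fun v u h1 h2 h3 h4 => ?_⟩
  -- `u i + c (v i)` is fixed by `a`, hence equal to `(a - 1) c (u i + c (v i))`
  have step : ∀ i, ∃ z, v (i + 1) = (τ + β • LinearMap.id : X →ₗ[k] X) (v i) + norm a b X z := by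
    intro i
    have hw : X.ρ a (u i + c (v i)) = u i + c (v i) := by
      rw [map_add, h3, lift _ (h1 i)]
      linear_combination (norm := module) two (v i)
    have hw' := lift _ hw
    have hb : X.ρ b (c (v i)) = c (v i) + τ (v i) := by
      have e := c_b (v i)
      rw [← τ_b, h2] at e
      linear_combination (norm := module) - e - two (τ (v i))
    refine ⟨c (u i + c (v i)), ?_⟩
    have hn : norm a b X (c (u i + c (v i))) =
        (u i + c (v i)) + X.ρ b (u i + c (v i)) := by
      simp only [norm, LinearMap.add_apply, LinearMap.comp_apply, LinearMap.id_apply]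
      rw [ρ_comm X a b, hw', map_add (X.ρ b)]
      linear_combination (norm := module) two (c (u i + c (v i))) + two (X.ρ b (c (u i + c (v i))))
    rw [hn, map_add (X.ρ b), h4, hb]
    simp only [LinearMap.add_apply, LinearMap.smul_apply, LinearMap.id_apply]
    linear_combination (norm := module) - two (τ (v i)) - two (β • v i) - two (u i) - two (c (v i))
  have all : ∀ i, ∃ z, v i =
      ((τ + β • LinearMap.id : Module.End k X) ^ i : Module.End k X) (v 0) + norm a b X z := by
    intro i
    induction i with
    | zero => exact ⟨0, by simp⟩
    | succ i ih =>
      obtain ⟨z, hz⟩ := ih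
      obtain ⟨z', hz'⟩ := step i
      refine ⟨(τ + β • LinearMap.id : X →ₗ[k] X) z + z', ?_⟩
      have hcomm : (τ + β • LinearMap.id : X →ₗ[k] X) (norm a b X z) =
          norm a b X ((τ + β • LinearMap.id : X →ₗ[k] X) z) := by
        simp [norm, τ_a, τ_b]
        module
      rw [hz', hz, map_add, hcomm, pow_succ', Module.End.mul_apply, map_add (norm a b X), add_assoc]
  obtain ⟨z, hz⟩ := all N
  refine ⟨m (v 0) + z, ?_⟩
  rw [hz, hm, map_add]
  simp [norm, conjSum, h1, h2]

/-- The bound passes from an object with a slope pair to the ideal it generates. -/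
lemma IsSlopePair.slopeBounded_of_idealOf [CharP k 2] {a b : V4} {X : FDRep k V4}
    {c τ : X →ₗ[k] X} (h : IsSlopePair a b X c τ) {β : k} {N : ℕ} (m : X →ₗ[k] X)
    (hm : ((τ + β • LinearMap.id : Module.End k X) ^ N : Module.End k X) = conjSum a b X m)
    {Y : FDRep k V4} (hY : idealOf X Y) : SlopeBounded a b β N Y := by
  obtain ⟨W, ⟨r⟩⟩ := hY
  refine SlopeBounded.retract ((h.tensor W).slopeBounded (β := β)
    (TensorProduct.map m LinearMap.id : X ⊗[k] W →ₗ[k] X ⊗[k] W) ?_) r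
  rw [conjSum_tensor, ← hm]
  have : (TensorProduct.map τ LinearMap.id + β • LinearMap.id : X ⊗[k] W →ₗ[k] X ⊗[k] W) =
      TensorProduct.map (τ + β • LinearMap.id) LinearMap.id := by
    rw [TensorProduct.map_add_left, TensorProduct.map_smul_left, TensorProduct.map_id]
  refine (congrArg (fun f : Module.End k (X ⊗[k] W) => f ^ N) this).trans ?_
  refine (TensorProduct.map_pow _ _ N).trans ?_
  congr 1
  exact one_pow N

end FDRep

/-! ### Pencils of matrices and Jordan blocks -/

namespace FDRep

open Matrix

variable {k : Type u} [Field k]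

/-- `a` and `b` generate the Klein four group and act by the unipotent block matrices with upper
right blocks `A` and `B`. -/
structure IsPencil {n : ℕ} (ρ : Representation k V4 (Fin n ⊕ Fin n → k)) (a b : V4)
    (A B : Matrix (Fin n) (Fin n) k) : Prop where
  univ_eq : (Finset.univ : Finset V4) = {1, a, b, a * b}
  ne : a ≠ 1 ∧ b ≠ 1 ∧ a ≠ b
  map_a : ρ a = toLin' (fromBlocks 1 A 0 1)
  map_b : ρ b = toLin' (fromBlocks 1 B 0 1)

/-- The generators of the Klein four group in the order in which the first one acts on `V_n(α)`
by the identity matrix as upper right block. -/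
def firstGen : OnePoint k → V4
  | none => Multiplicative.ofAdd (0, 1)
  | some _ => Multiplicative.ofAdd (1, 0)

/-- The generator complementary to `firstGen`. -/
def secondGen : OnePoint k → V4
  | none => Multiplicative.ofAdd (1, 0)
  | some _ => Multiplicative.ofAdd (0, 1)

/-- The eigenvalue of the Jordan block by which `secondGen` acts on `V_n(α)`. -/
def pencilSlope : OnePoint k → k
  | none => 0
  | some a => a

section Pencil

variable [CharP k 2]

lemma isPencil_finite {n : ℕ} (S T : Matrix (Fin n) (Fin n) k) :
    IsPencil (pencilRep S T) (Multiplicative.ofAdd (1, 0)) (Multiplicative.ofAdd (0, 1)) S T where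
  univ_eq := by decide
  ne := by decide
  map_a := by simp [pencilRep]
  map_b := by simp [pencilRep]

lemma isPencil_infinite {n : ℕ} (S T : Matrix (Fin n) (Fin n) k) :
    IsPencil (pencilRep S T) (Multiplicative.ofAdd (0, 1)) (Multiplicative.ofAdd (1, 0)) T S where
  univ_eq := by decide
  ne := by decide
  map_a := by simp [pencilRep]
  map_b := by simp [pencilRep]

lemma exists_isPencil (n : ℕ) (α : OnePoint k) :
    ∃ ρ : Representation k V4 (Fin n ⊕ Fin n → k), moduleV n α = FDRep.of ρ ∧
      IsPencil ρ (firstGen α) (secondGen α) 1 (jordanBlock n (pencilSlope α)) :=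
  match α with
  | none => ⟨_, rfl, isPencil_infinite _ _⟩
  | some _ => ⟨_, rfl, isPencil_finite _ _⟩

variable {n : ℕ} {ρ : Representation k V4 (Fin n ⊕ Fin n → k)} {a b : V4}

lemma IsPencil.isSlopePair {T : Matrix (Fin n) (Fin n) k} (h : IsPencil ρ a b 1 T) :
    IsSlopePair a b (FDRep.of ρ) (toLin' (fromBlocks 0 0 1 1))
      (toLin' (fromBlocks T (T * T + T) 0 T)) := by
  have two := add_self_eq_zero (k := k) (M := Matrix (Fin n) (Fin n) k)
  set c : Matrix (Fin n ⊕ Fin n) (Fin n ⊕ Fin n) k := fromBlocks 0 0 1 1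
  set τ : Matrix (Fin n ⊕ Fin n) (Fin n ⊕ Fin n) k := fromBlocks T (T * T + T) 0 T
  have h1 : toLin' c ∘ₗ ρ a = ρ a + ρ a ∘ₗ toLin' c := by
    rw [h.map_a, ← toLin'_mul, ← toLin'_mul, ← map_add, fromBlocks_multiply, fromBlocks_multiply,
      fromBlocks_add]
    simp [two]
  have h2 : toLin' c ∘ₗ ρ b = ρ b ∘ₗ toLin' τ + ρ b ∘ₗ toLin' c := by
    rw [h.map_b, ← toLin'_mul, ← toLin'_mul, ← toLin'_mul, ← map_add, fromBlocks_multiply,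
      fromBlocks_multiply, fromBlocks_multiply, fromBlocks_add]
    congr 2
    · simp [two]
    · linear_combination (norm := noncomm_ring) - two T - two (T * T)
    · simp
    · noncomm_ring
  have h3 : toLin' τ ∘ₗ ρ a = ρ a ∘ₗ toLin' τ := by
    rw [h.map_a, ← toLin'_mul, ← toLin'_mul, fromBlocks_multiply, fromBlocks_multiply]
    simp [add_comm]
  have h4 : toLin' τ ∘ₗ ρ b = ρ b ∘ₗ toLin' τ := by
    rw [h.map_b, ← toLin'_mul, ← toLin'_mul, fromBlocks_multiply, fromBlocks_multiply]
    simp [add_comm]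
  exact ⟨h1, h2, h3, h4⟩

omit [CharP k 2] in
lemma fromBlocks_pow {σ Y : Matrix (Fin n) (Fin n) k} (h : Commute σ Y) (N : ℕ) :
    fromBlocks σ Y 0 σ ^ N = fromBlocks (σ ^ N) (N • (σ ^ (N - 1) * Y)) 0 (σ ^ N) := by
  induction N with
  | zero => simp [fromBlocks_one]
  | succ N ih =>
    rw [pow_succ', ih, fromBlocks_multiply]
    congr 1
    · simp [pow_succ']
    · cases N with
      | zero => simp
      | succ N =>
        simp only [Nat.add_sub_cancel, mul_smul_comm, ← mul_assoc, ← pow_succ']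
        rw [(h.symm.pow_right (N + 1)).eq]
        module
    · simp
    · simp [pow_succ']

lemma IsPencil.conjSum_eq {T : Matrix (Fin n) (Fin n) k} (h : IsPencil ρ a b 1 T)
    (Q : Matrix (Fin n) (Fin n) k) :
    conjSum a b (FDRep.of ρ) (toLin' (fromBlocks 0 0 Q 0)) =
      toLin' (fromBlocks 0 (T * Q + Q * T) 0 0) := by
  have two := add_self_eq_zero (k := k) (M := Matrix (Fin n) (Fin n) k)
  have key : toLin' (fromBlocks 0 0 Q 0) + ρ a ∘ₗ toLin' (fromBlocks 0 0 Q 0) ∘ₗ ρ a +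
      ρ b ∘ₗ toLin' (fromBlocks 0 0 Q 0) ∘ₗ ρ b +
      ρ a ∘ₗ ρ b ∘ₗ toLin' (fromBlocks 0 0 Q 0) ∘ₗ ρ b ∘ₗ ρ a =
      toLin' (fromBlocks 0 (T * Q + Q * T) 0 0) := by
    simp only [h.map_a, h.map_b, ← toLin'_mul, ← map_add,
      fromBlocks_multiply, fromBlocks_add]
    congr 2
    · linear_combination (norm := noncomm_ring) two Q + two (T * Q)
    · linear_combination (norm := noncomm_ring) two Q + two (T * Q * T)
    · linear_combination (norm := noncomm_ring) two Q + two Q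
    · linear_combination (norm := noncomm_ring) two Q + two (Q * T)
  exact key

end Pencil

section Jordan

lemma jordanBlock_add_smul_one [CharP k 2] (n : ℕ) (α : k) :
    jordanBlock n α + α • 1 = jordanBlock n 0 := by
  ext i j
  by_cases h : i = j
  · simp [jordanBlock, h, CharTwo.add_self_eq_zero]
  · simp [jordanBlock, h]

lemma jordanBlock_zero_pow_apply (n N : ℕ) (i j : Fin n) :
    (jordanBlock n (0 : k) ^ N) i j = if (i : ℕ) = j + N then 1 else 0 := by
  induction N generalizing i with
  | zero => simp [Matrix.one_apply, Fin.ext_iff]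
  | succ N ih =>
    rw [pow_succ', Matrix.mul_apply]
    simp only [ih]
    by_cases h : (i : ℕ) = j + (N + 1)
    · rw [if_pos h, Finset.sum_eq_single (⟨j + N, by omega⟩ : Fin n)]
      · simp [jordanBlock, Fin.ext_iff, h]; omega
      · intro b _ hb
        have : (b : ℕ) ≠ j + N := fun e => hb (Fin.ext e)
        simp [this]
      · simp
    · rw [if_neg h]
      refine Finset.sum_eq_zero fun b _ => ?_
      by_cases hb : (b : ℕ) = j + N
      · have : (i : ℕ) ≠ b + 1 := by omega
        simp [jordanBlock, this]
      · simp [hb]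

lemma jordanBlock_zero_pow_eq_zero {n N : ℕ} (h : n ≤ N) : jordanBlock n (0 : k) ^ N = 0 := by
  ext i j
  rw [jordanBlock_zero_pow_apply, if_neg (by omega)]
  rfl

lemma le_of_jordanBlock_zero_pow_eq_zero {n N : ℕ} (h : jordanBlock n (0 : k) ^ N = 0) :
    n ≤ N := by
  by_contra! hlt
  have := congrFun (congrFun h ⟨N, hlt⟩) ⟨0, by omega⟩
  rw [jordanBlock_zero_pow_apply] at this
  simp at this

end Jordan

end FDRep

/-! ### The slope bound for the modules `V_n(α)` -/

namespace FDRep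

open Matrix

variable {k : Type u} [Field k]

/-- For `n ≥ 2` the top power of the nilpotent Jordan block is an (anti)commutator. -/
lemma exists_commutator_eq_pow {n : ℕ} (hn : 2 ≤ n) : ∃ E : Matrix (Fin n) (Fin n) k,
    jordanBlock n 0 * E + E * jordanBlock n 0 = jordanBlock n 0 ^ (n - 1) := by
  refine ⟨Matrix.of fun i j => if (i : ℕ) + 2 = n ∧ (j : ℕ) = 0 then 1 else 0, ?_⟩
  ext i j
  rw [jordanBlock_zero_pow_apply, Matrix.add_apply, Matrix.mul_apply, Matrix.mul_apply,
    Finset.sum_eq_zero (s := Finset.univ) (f := fun l : Fin n =>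
      (Matrix.of fun i j : Fin n => if (i : ℕ) + 2 = n ∧ (j : ℕ) = 0 then (1 : k) else 0) i l *
        jordanBlock n 0 l j), add_zero, Finset.sum_eq_single (⟨n - 2, by omega⟩ : Fin n)]
  · by_cases hj : (j : ℕ) = 0
    · by_cases hi : (i : ℕ) = n - 1
      · have h1 : (i : ℕ) = n - 2 + 1 := by omega
        have h2 : n - 2 + 2 = n := by omega
        rw [if_pos (by omega)]
        simp [jordanBlock, Fin.ext_iff, hj, h1, h2]
      · have h1 : (i : ℕ) ≠ n - 2 + 1 := by omega
        simp [jordanBlock, Fin.ext_iff, hj, hi, h1]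
    · have h1 : (i : ℕ) ≠ j + (n - 1) := by omega
      simp [hj, h1]
  · intro l _ hl
    have : (l : ℕ) + 2 ≠ n := fun e => hl (Fin.ext (by simp; omega))
    simp [this]
  · simp
  · intro l _
    by_cases hl : (l : ℕ) = 0
    · simp [jordanBlock, Fin.ext_iff, hl]
    · simp [hl]

variable [CharP k 2] {n : ℕ} {ρ : Representation k V4 (Fin n ⊕ Fin n → k)} {a b : V4}

lemma jordanBlock_eq (n : ℕ) (α : k) : jordanBlock n α = jordanBlock n 0 + α • 1 := by
  rw [← jordanBlock_add_smul_one n α, add_assoc, add_self_eq_zero (k := k), add_zero]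

/-- The right-hand side is the off-diagonal block of `(τ - α) ^ N` for the slope operator `τ` of
`V_n(α)` (see `slope_pow`), and the left-hand side is the off-diagonal block of a relative trace. So
`(τ - α) ^ N` is zero modulo projectives for `N > n`, and for `N = n` unless `n = 1` and
`α ≠ 0, 1`. -/
lemma exists_commutator_eq {α : k} {N : ℕ} (hN : n < N ∨ n = N ∧ (2 ≤ n ∨ α * α + α = 0)) :
    ∃ Q : Matrix (Fin n) (Fin n) k, jordanBlock n α * Q + Q * jordanBlock n α =
      N • (jordanBlock n 0 ^ (N - 1) * (jordanBlock n α * jordanBlock n α + jordanBlock n α)) := by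
  rcases hN with hN | ⟨rfl, hN⟩
  · exact ⟨0, by rw [jordanBlock_zero_pow_eq_zero (by omega)]; simp⟩
  -- multiplication by the top power of the nilpotent block replaces the Jordan block by `α`
  have hY : n • (jordanBlock n 0 ^ (n - 1) *
      (jordanBlock n α * jordanBlock n α + jordanBlock n α)) =
      (n * (α * α + α)) • jordanBlock n (0 : k) ^ (n - 1) := by
    rcases Nat.eq_zero_or_pos n with rfl | hn
    · simp
    have h0 : jordanBlock n (0 : k) ^ (n - 1) * jordanBlock n 0 = 0 := by
      rw [← pow_succ]
      exact jordanBlock_zero_pow_eq_zero (by omega)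
    have h1 : jordanBlock n (0 : k) ^ (n - 1) * jordanBlock n α =
        α • jordanBlock n (0 : k) ^ (n - 1) := by
      rw [jordanBlock_eq n α, mul_add, h0, zero_add, mul_smul_comm, mul_one]
    rw [mul_add, ← mul_assoc, h1, smul_mul_assoc, h1]
    module
  rw [hY]
  rcases hN with hn | h0
  · obtain ⟨E, hE⟩ := exists_commutator_eq_pow (k := k) hn
    refine ⟨(n * (α * α + α)) • E, ?_⟩
    rw [← hE, jordanBlock_eq n α]
    have two := add_self_eq_zero (k := k) (α • E)
    simp only [add_mul, mul_add, smul_mul_assoc, mul_smul_comm, one_mul, mul_one]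
    linear_combination (norm := module) (n * (α * α + α)) • two
  · exact ⟨0, by simp [h0]⟩

lemma slope_pow (α : k) (N : ℕ) :
    ((toLin' (fromBlocks (jordanBlock n α) (jordanBlock n α * jordanBlock n α + jordanBlock n α) 0
      (jordanBlock n α)) + α • LinearMap.id : Module.End k (Fin n ⊕ Fin n → k)) ^ N :
      Module.End k (Fin n ⊕ Fin n → k)) =
    toLin' (fromBlocks (jordanBlock n 0 ^ N) (N • (jordanBlock n 0 ^ (N - 1) *
      (jordanBlock n α * jordanBlock n α + jordanBlock n α))) 0 (jordanBlock n 0 ^ N)) := by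
  rw [← fromBlocks_pow, toLin'_pow, ← jordanBlock_add_smul_one n α]
  · congr 1
    rw [← toLin'_one, ← map_smul, ← map_add, ← fromBlocks_one, fromBlocks_smul, fromBlocks_add]
    simp
  · have : Commute (jordanBlock n 0) (jordanBlock n α) := by
      rw [jordanBlock_eq n α]
      exact (Commute.refl _).add_right ((Commute.one_right _).smul_right α)
    exact (this.mul_right this).add_right this

lemma IsPencil.slopeBounded {α : k} (h : IsPencil ρ a b 1 (jordanBlock n α)) {N : ℕ}
    (hN : n < N ∨ n = N ∧ (2 ≤ n ∨ α * α + α = 0)) {Y : FDRep k V4}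
    (hY : idealOf (FDRep.of ρ) Y) : SlopeBounded a b α N Y := by
  obtain ⟨Q, hQ⟩ := exists_commutator_eq hN
  refine h.isSlopePair.slopeBounded_of_idealOf (toLin' (fromBlocks 0 0 Q 0)) ?_ hY
  rw [h.conjSum_eq]
  refine (slope_pow α N).trans ?_
  rw [hQ, jordanBlock_zero_pow_eq_zero]
  omega

lemma IsPencil.norm_eq_zero {A B : Matrix (Fin n) (Fin n) k} (h : IsPencil ρ a b A B) :
    norm a b (FDRep.of ρ) = 0 := by
  have key : LinearMap.id + ρ a + ρ b + ρ a ∘ₗ ρ b = 0 := by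
    have two := add_self_eq_zero (k := k) (M := Matrix (Fin n) (Fin n) k)
    rw [h.map_a, h.map_b, ← toLin'_one, ← toLin'_mul, ← map_add, ← map_add, ← map_add,
      ← fromBlocks_one, fromBlocks_multiply, fromBlocks_add, fromBlocks_add, fromBlocks_add,
      ← map_zero toLin', ← fromBlocks_zero]
    congr 2
    · linear_combination (norm := noncomm_ring) two 1 + two 1
    · linear_combination (norm := noncomm_ring) two A + two B
    · simp
    · linear_combination (norm := noncomm_ring) two 1 + two 1
  exact key

omit [CharP k 2] in
lemma toLin'_fromBlocks_apply (A : Matrix (Fin n) (Fin n) k) (v w : Fin n → k) :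
    toLin' (fromBlocks 1 A 0 1) (Sum.elim v w) = Sum.elim (v + A *ᵥ w) w := by
  rw [toLin'_apply, fromBlocks_mulVec]
  simp

/-- What the slope bound means for a pencil `(A, B)`: the first matrix is invertible, and the
quotient `B / A` has no eigenvalue besides `β`, with nilpotency index at most `N`. -/
lemma IsPencil.exists_inverse {A B : Matrix (Fin n) (Fin n) k} (h : IsPencil ρ a b A B) {β : k}
    {N : ℕ} (hb : SlopeBounded a b β N (FDRep.of ρ)) :
    ∃ C, A * C = 1 ∧ (B * C + β • 1) ^ N = 0 := by
  have ha : ∀ v w, ρ a (Sum.elim v w) = Sum.elim (v + A *ᵥ w) w := fun v w => by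
    rw [h.map_a, toLin'_fromBlocks_apply]
  have hbb : ∀ v w, ρ b (Sum.elim v w) = Sum.elim (v + B *ᵥ w) w := fun v w => by
    rw [h.map_b, toLin'_fromBlocks_apply]
  have hsurj : Function.Surjective (A *ᵥ ·) := by
    intro v
    obtain ⟨u, hu⟩ := hb.lift (Sum.elim v 0 : Fin n ⊕ Fin n → k)
      ((ha v 0).trans (by simp))
    refine ⟨u ∘ Sum.inr, ?_⟩
    have hu' : ρ a u = u + Sum.elim v 0 := hu
    rw [← Sum.elim_comp_inl_inr u, ha] at hu'
    have := congrArg (· ∘ Sum.inl) hu'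
    funext i
    simpa using congrFun this i
  obtain ⟨C, hC⟩ := Matrix.mulVec_surjective_iff_exists_right_inverse.1 hsurj
  refine ⟨C, hC, ?_⟩
  have two := add_self_eq_zero (k := k) (M := Fin n → k)
  refine Matrix.ext_of_mulVec_single fun j => ?_
  -- the chain of invariants `w i` in the bottom half, joined by the top vectors `C w i`
  let w : ℕ → Fin n → k := fun i => ((B * C + β • 1) ^ i) *ᵥ Pi.single j 1
  obtain ⟨z, hz⟩ := hb.chain (fun i => (Sum.elim (w i) 0 : Fin n ⊕ Fin n → k))
    (fun i => (Sum.elim 0 (C *ᵥ w i) : Fin n ⊕ Fin n → k))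
    (fun i => (ha _ _).trans (by simp)) (fun i => (hbb _ _).trans (by simp))
    (fun i => (ha _ _).trans (by
      show _ = (Sum.elim 0 (C *ᵥ w i) : Fin n ⊕ Fin n → k) + Sum.elim (w i) 0
      rw [mulVec_mulVec, hC]
      ext (l | l) <;> simp))
    (fun i => (hbb _ _).trans (by
      show _ = (Sum.elim 0 (C *ᵥ w i) : Fin n ⊕ Fin n → k) +
        (β • Sum.elim (w i) 0 + Sum.elim (w (i + 1)) 0)
      have hw : w (i + 1) = (B * C) *ᵥ w i + β • w i := by
        simp only [w]
        rw [pow_succ', ← mulVec_mulVec, add_mulVec, smul_mulVec, one_mulVec]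
      have e : B *ᵥ C *ᵥ w i = β • w i + w (i + 1) := by
        rw [hw, mulVec_mulVec]
        linear_combination (norm := module) - two (β • w i)
      rw [e]
      ext (l | l) <;> simp))
  rw [h.norm_eq_zero] at hz
  have hz' : (Sum.elim (w N) 0 : Fin n ⊕ Fin n → k) = 0 := hz
  have := congrArg (· ∘ Sum.inl) hz'
  rw [zero_mulVec]
  exact this

/-- On a projective module every invariant is a norm, but the norm of a pencil is zero. -/
lemma IsPencil.not_projective {A B : Matrix (Fin n) (Fin n) k} (h : IsPencil ρ a b A B)
    (hn : 1 ≤ n) : ¬ Projective (FDRep.of ρ) := by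
  intro hP
  obtain ⟨m, hm⟩ := isTraceOne_of_projective hP
  let v : Fin n ⊕ Fin n → k := Sum.elim (fun _ => 1) 0
  have hv : ∀ x, ρ x v = v := by
    intro x
    have ha : ρ a v = v := by rw [h.map_a, toLin'_fromBlocks_apply]; simp [v]
    have hb : ρ b v = v := by rw [h.map_b, toLin'_fromBlocks_apply]; simp [v]
    have hx : x ∈ (Finset.univ : Finset V4) := Finset.mem_univ x
    rw [h.univ_eq] at hx
    simp only [Finset.mem_insert, Finset.mem_singleton] at hx
    rcases hx with rfl | rfl | rfl | rfl
    · simp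
    · exact ha
    · exact hb
    · rw [map_mul, Module.End.mul_apply, hb, ha]
  have h1 : v = ∑ x, ρ x (m (ρ x⁻¹ v)) := by
    refine Eq.trans ?_ (lin_average_apply (X := FDRep.of ρ) m v)
    rw [hm]
    rfl
  have h2 : ∀ w, ∑ x, ρ x w = norm a b (FDRep.of ρ) w := by
    intro w
    obtain ⟨ha, hb, hab⟩ := h.ne
    rw [h.univ_eq, Finset.sum_insert, Finset.sum_insert, Finset.sum_insert, Finset.sum_singleton]
    · simp only [norm, map_one, map_mul]
      rw [← add_assoc, ← add_assoc]
      rfl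
    · simp [ha]
    · simp [hab, hb]
    · simp only [Finset.mem_insert, Finset.mem_singleton, not_or]
      refine ⟨ha.symm, hb.symm, fun e => hab ?_⟩
      rw [← V4.mul_self b] at e
      exact (mul_right_cancel e).symm
  rw [Finset.sum_congr rfl fun x _ => by rw [hv], h2, h.norm_eq_zero] at h1
  have h0 : v = 0 := h1
  have := congrFun h0 (Sum.inl ⟨0, hn⟩)
  simp [v] at this

end FDRep

/-! ### Retracts of `V_n(α) ⊗ U` -/

namespace FDRep

open Matrix

variable {k : Type u} [Field k]

lemma IsPencil.equivariant {n : ℕ} {ρ : Representation k V4 (Fin n ⊕ Fin n → k)} {a b : V4}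
    {A B : Matrix (Fin n) (Fin n) k} (h : IsPencil ρ a b A B) {X Y : FDRep k V4} (f : X →ₗ[k] Y)
    (ha : ∀ x, f (X.ρ a x) = Y.ρ a (f x)) (hb : ∀ x, f (X.ρ b x) = Y.ρ b (f x)) (g : V4) (x : X) :
    f (X.ρ g x) = Y.ρ g (f x) := by
  have hg : g ∈ (Finset.univ : Finset V4) := Finset.mem_univ g
  rw [h.univ_eq] at hg
  simp only [Finset.mem_insert, Finset.mem_singleton] at hg
  rcases hg with rfl | rfl | rfl | rfl
  · simp
  · exact ha x
  · exact hb x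
  · rw [ρ_mul_apply, ρ_mul_apply, ha, hb]

lemma toLin'_fromBlocks_single_inr {n : ℕ} (M : Matrix (Fin n) (Fin n) k) (j : Fin n) :
    toLin' (fromBlocks (1 : Matrix (Fin n) (Fin n) k) M 0 (1 : Matrix (Fin n) (Fin n) k))
      (Pi.single (Sum.inr j) 1 : Fin n ⊕ Fin n → k) =
      Pi.single (Sum.inr j) 1 + ∑ i, M i j • (Pi.single (Sum.inl i) 1 : Fin n ⊕ Fin n → k) := by
  rw [toLin'_apply, mulVec_single_one]
  ext (i | i) <;> simp [Matrix.one_apply, Pi.single_apply]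

lemma toLin'_fromBlocks_single_inl {n : ℕ} (M : Matrix (Fin n) (Fin n) k) (j : Fin n) :
    toLin' (fromBlocks (1 : Matrix (Fin n) (Fin n) k) M 0 (1 : Matrix (Fin n) (Fin n) k))
      (Pi.single (Sum.inl j) 1 : Fin n ⊕ Fin n → k) =
      Pi.single (Sum.inl j) 1 := by
  rw [toLin'_apply, mulVec_single_one]
  ext (i | i) <;> simp [Matrix.one_apply, Pi.single_apply]

variable [CharP k 2]

/-- The powers of `τ + α` with `(τ + α) ^ n = 0`, in descending order, are an eigenvector of the
transposed Jordan block with eigenvalue `τ`. -/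
lemma sum_jordanBlock_smul_pow {M : Type*} [AddCommGroup M] [Module k M] {n : ℕ} {α : k}
    {τ : Module.End k M} (hτ : (τ + α • 1) ^ n = 0) (i : Fin n) :
    ∑ j, jordanBlock n α i j • (τ + α • 1) ^ (j.rev : ℕ) = τ * (τ + α • 1) ^ (i.rev : ℕ) := by
  have two := add_self_eq_zero (k := k) (M := Module.End k M)
  have hsplit : ∀ j, jordanBlock n α i j • (τ + α • 1) ^ (j.rev : ℕ) =
      (if j = i then α • (τ + α • 1) ^ (i.rev : ℕ) else 0) +
      (if (i : ℕ) = j + 1 then (τ + α • 1) ^ (i.rev + 1 : ℕ) else 0) := by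
    intro j
    by_cases h : i = j
    · subst h
      simp [jordanBlock]
    · by_cases h' : (i : ℕ) = j + 1
      · have : (j.rev : ℕ) = i.rev + 1 := by
          rw [Fin.val_rev, Fin.val_rev]
          omega
        rw [if_neg (Ne.symm h), if_pos h', this, zero_add]
        simp [jordanBlock, h, h', -Fin.val_rev]
      · simp [jordanBlock, h, Ne.symm h, h']
  rw [Finset.sum_congr rfl fun j _ => hsplit j, Finset.sum_add_distrib, Finset.sum_ite_eq',
    if_pos (Finset.mem_univ i)]
  have hsum : ∑ j : Fin n, (if (i : ℕ) = j + 1 then (τ + α • 1) ^ (i.rev + 1 : ℕ) else 0) =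
      (τ + α • 1) ^ (i.rev + 1 : ℕ) := by
    by_cases hi : (i : ℕ) = 0
    · have : (i.rev + 1 : ℕ) = n := by rw [Fin.val_rev]; omega
      rw [this, hτ]
      simp
    · rw [Finset.sum_eq_single (⟨i - 1, by omega⟩ : Fin n), if_pos (by simp; omega)]
      · intro j _ hj
        exact if_neg fun e => hj (Fin.ext (by simp; omega))
      · simp
  rw [hsum, pow_succ', add_mul, smul_mul_assoc, one_mul]
  linear_combination (norm := module) two (α • (τ + α • 1) ^ (i.rev : ℕ))

/-- If the slope operator `τ` of `U` satisfies `(τ - α) ^ n = 0`, then `U` is a retract of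
`V_n(α) ⊗ U`. The retraction evaluates the last top coordinate of `V_n(α)`. Writing `eⱼ`, `fⱼ` for the
top and bottom basis vectors, the section is
`u ↦ ∑ j, (eⱼ ⊗ (τ - α) ^ (n - 1 - j) u + fⱼ ⊗ c (τ - α) ^ (n - 1 - j) u)`. -/
lemma IsPencil.idealOf_of_slopePair {n : ℕ} {ρ : Representation k V4 (Fin n ⊕ Fin n → k)}
    {a b : V4} {α : k} (h : IsPencil ρ a b 1 (jordanBlock n α)) (hn : 1 ≤ n) {U : FDRep k V4}
    {c τ : U →ₗ[k] U} (hU : IsSlopePair a b U c τ)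
    (hτ : ((τ + α • LinearMap.id : Module.End k U) ^ n : Module.End k U) = 0) :
    idealOf (FDRep.of ρ) U := by
  obtain ⟨p, rfl⟩ : ∃ p, n = p + 1 := ⟨n - 1, by omega⟩
  let V : FDRep k V4 := FDRep.of ρ
  let e (j : Fin (p + 1)) : V := (Pi.single (Sum.inr j) 1 : Fin (p + 1) ⊕ Fin (p + 1) → k)
  let f (j : Fin (p + 1)) : V := (Pi.single (Sum.inl j) 1 : Fin (p + 1) ⊕ Fin (p + 1) → k)
  have hcol : ∀ (M : Matrix (Fin (p + 1)) (Fin (p + 1)) k) (j : Fin (p + 1)),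
      toLin' (fromBlocks (1 : Matrix (Fin (p + 1)) _ k) M 0 (1 : Matrix (Fin (p + 1)) _ k))
        (Pi.single (Sum.inr j) 1 : Fin (p + 1) ⊕ Fin (p + 1) → k) =
        (e j + ∑ i, M i j • f i : V) := toLin'_fromBlocks_single_inr
  have hcol' : ∀ (M : Matrix (Fin (p + 1)) (Fin (p + 1)) k) (j : Fin (p + 1)),
      toLin' (fromBlocks (1 : Matrix (Fin (p + 1)) _ k) M 0 (1 : Matrix (Fin (p + 1)) _ k))
        (Pi.single (Sum.inl j) 1 : Fin (p + 1) ⊕ Fin (p + 1) → k) =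
        f j := toLin'_fromBlocks_single_inl
  have hae : ∀ j, V.ρ a (e j) = e j + f j := by
    intro j
    show ρ a _ = _
    rw [h.map_a]
    refine (hcol 1 j).trans (congrArg (e j + ·) ?_)
    simp [Matrix.one_apply]
  have haf : ∀ j, V.ρ a (f j) = f j := by
    intro j
    show ρ a _ = _
    rw [h.map_a]
    exact hcol' _ j
  have hbe : ∀ j, V.ρ b (e j) = e j + ∑ i, jordanBlock (p + 1) α i j • f i := by
    intro j
    show ρ b _ = _
    rw [h.map_b]
    exact hcol _ j
  have hbf : ∀ j, V.ρ b (f j) = f j := by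
    intro j
    show ρ b _ = _
    rw [h.map_b]
    exact hcol' _ j
  let P (j : Fin (p + 1)) : Module.End k U := (τ + α • 1) ^ (j.rev : ℕ)
  have c_a : ∀ v, c (U.ρ a v) = U.ρ a v + U.ρ a (c v) := fun v => LinearMap.congr_fun hU.c_a v
  have c_b : ∀ v, c (U.ρ b v) = U.ρ b (τ v) + U.ρ b (c v) := fun v => LinearMap.congr_fun hU.c_b v
  have hcomm : ∀ g, τ ∘ₗ U.ρ g = U.ρ g ∘ₗ τ → ∀ j v, P j (U.ρ g v) = U.ρ g (P j v) := by
    intro g hg j v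
    have : Commute (τ + α • 1 : Module.End k U) (U.ρ g) :=
      Commute.add_left hg ((Commute.one_left _).smul_left α)
    exact LinearMap.congr_fun (this.pow_left (j.rev : ℕ)).eq v
  have P_a := hcomm a hU.τ_a
  have P_b := hcomm b hU.τ_b
  have hJ : ∀ i v, ∑ j, jordanBlock (p + 1) α i j • P j v = τ (P i v) := by
    intro i v
    have := LinearMap.congr_fun (sum_jordanBlock_smul_pow (α := α) (τ := τ) hτ i) v
    rw [LinearMap.sum_apply] at this
    exact this
  -- equivariance under `a` amounts to `c a = a + a c`, equivariance under `b` to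
  -- `c b = b τ + b c` together with `hJ`
  let s : U →ₗ[k] V ⊗[k] U := ∑ j, (TensorProduct.mk k V U (e j) ∘ₗ P j +
    TensorProduct.mk k V U (f j) ∘ₗ c ∘ₗ P j)
  have hs : ∀ u, s u = ∑ j, (e j ⊗ₜ[k] P j u + f j ⊗ₜ[k] c (P j u)) := by
    intro u
    simp [s, LinearMap.sum_apply]
  let l : V →ₗ[k] k := LinearMap.proj (φ := fun _ : Fin (p + 1) ⊕ Fin (p + 1) => k)
    (Sum.inr (Fin.last p))
  have hltop : ∀ (M : Matrix (Fin (p + 1)) (Fin (p + 1)) k) (v : Fin (p + 1) ⊕ Fin (p + 1) → k),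
      toLin' (fromBlocks 1 M 0 1) v (Sum.inr (Fin.last p)) = v (Sum.inr (Fin.last p)) := by
    intro M v
    rw [← Sum.elim_comp_inl_inr v, toLin'_fromBlocks_apply]
    rfl
  have hla : ∀ v, l (V.ρ a v) = l v := by
    intro v
    show ρ a v _ = _
    rw [h.map_a]
    exact hltop _ v
  have hlb : ∀ v, l (V.ρ b v) = l v := by
    intro v
    show ρ b v _ = _
    rw [h.map_b]
    exact hltop _ v
  have hle : ∀ j, l (e j) = if j = Fin.last p then 1 else 0 := by
    intro j
    show (Pi.single (Sum.inr j) 1 : Fin (p + 1) ⊕ Fin (p + 1) → k) (Sum.inr (Fin.last p)) = _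
    simp [Pi.single_apply, eq_comm]
  have hlf : ∀ j, l (f j) = 0 := by
    intro j
    show (Pi.single (Sum.inl j) 1 : Fin (p + 1) ⊕ Fin (p + 1) → k) (Sum.inr (Fin.last p)) = _
    simp
  let r : V ⊗[k] U →ₗ[k] U := TensorProduct.lid k U ∘ₗ TensorProduct.map l LinearMap.id
  have hr : ∀ v u, r (v ⊗ₜ[k] u) = l v • u := fun v u => rfl
  have hsa : ∀ u, s (U.ρ a u) = TensorProduct.map (V.ρ a) (U.ρ a) (s u) := by
    intro u
    rw [hs, hs, map_sum]
    refine Finset.sum_congr rfl fun j _ => ?_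
    simp only [map_add, TensorProduct.map_tmul, hae, haf, P_a, c_a, TensorProduct.add_tmul,
      TensorProduct.tmul_add]
    abel
  have hsb : ∀ u, s (U.ρ b u) = TensorProduct.map (V.ρ b) (U.ρ b) (s u) := by
    intro u
    rw [hs, hs, map_sum]
    simp only [map_add, TensorProduct.map_tmul, hbe, hbf, P_b, c_b, TensorProduct.add_tmul,
      TensorProduct.tmul_add, Finset.sum_add_distrib]
    have : ∑ j, (∑ i, jordanBlock (p + 1) α i j • f i) ⊗ₜ[k] U.ρ b (P j u) =
        ∑ i, f i ⊗ₜ[k] U.ρ b (τ (P i u)) := by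
      simp only [← hJ, map_sum, map_smul, TensorProduct.sum_tmul, TensorProduct.tmul_sum,
        TensorProduct.smul_tmul]
      exact Finset.sum_comm
    rw [this, add_assoc]
  have hra : ∀ t, r (TensorProduct.map (V.ρ a) (U.ρ a) t) = U.ρ a (r t) := by
    intro t
    refine LinearMap.congr_fun (f := r ∘ₗ TensorProduct.map (V.ρ a) (U.ρ a)) (g := U.ρ a ∘ₗ r)
      (TensorProduct.ext' fun v u => ?_) t
    simp only [LinearMap.comp_apply, TensorProduct.map_tmul, hr, hla, map_smul]
  have hrb : ∀ t, r (TensorProduct.map (V.ρ b) (U.ρ b) t) = U.ρ b (r t) := by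
    intro t
    refine LinearMap.congr_fun (f := r ∘ₗ TensorProduct.map (V.ρ b) (U.ρ b)) (g := U.ρ b ∘ₗ r)
      (TensorProduct.ext' fun v u => ?_) t
    simp only [LinearMap.comp_apply, TensorProduct.map_tmul, hr, hlb, map_smul]
  let i' : U ⟶ MonoidalCategoryStruct.tensorObj V U := 
    homMk s (h.equivariant (Y := MonoidalCategoryStruct.tensorObj V U) s hsa hsb)
  let r' : MonoidalCategoryStruct.tensorObj V U ⟶ U := 
    homMk r (h.equivariant (X := MonoidalCategoryStruct.tensorObj V U) r hra hrb)
  refine ⟨U, ⟨⟨i', r', lin_injective (LinearMap.ext fun u => ?_)⟩⟩⟩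
  show r (s u) = u
  rw [hs, map_sum, Finset.sum_eq_single (Fin.last p)]
  · rw [map_add, hr, hr, hle, hlf, if_pos rfl, one_smul, zero_smul, add_zero]
    simp [P]
  · intro j _ hj
    rw [map_add, hr, hr, hle, hlf, if_neg hj, zero_smul, zero_smul, add_zero]
  · simp

end FDRep

/-! ### The tensor square of `V_1(α)` -/

namespace FDRep

open Matrix

variable {k : Type u} [Field k] [CharP k 2]

/-- The map `V_1(α) ⊗ V_1(α) ⟶ V_2(α)`. With `e`, `f` the top and bottom basis vectors of `V_1(α)`, it
sends `e ⊗ e` to the first top vector of `V_2(α)` and `e ⊗ f` to `δ` times the second one; if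
`δ = (α² + α)⁻¹`, this determines it by equivariance. -/
def tensorSquareMap (δ : k) :
    (Fin 1 ⊕ Fin 1 → k) ⊗[k] (Fin 1 ⊕ Fin 1 → k) →ₗ[k] (Fin 2 ⊕ Fin 2 → k) :=
  TensorProduct.lift (LinearMap.mk₂ k (fun x y => Sum.elim
      ![x (Sum.inl 0) * y (Sum.inr 0),
        δ * (x (Sum.inl 0) * y (Sum.inl 0) + x (Sum.inl 0) * y (Sum.inr 0))]
      ![x (Sum.inr 0) * y (Sum.inr 0),
        δ * (x (Sum.inr 0) * y (Sum.inl 0) + x (Sum.inl 0) * y (Sum.inr 0))])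
      (fun x x' y => by ext (i | i) <;> fin_cases i <;> simp <;> ring)
      (fun r x y => by ext (i | i) <;> fin_cases i <;> simp <;> ring)
      (fun x y y' => by ext (i | i) <;> fin_cases i <;> simp <;> ring)
      (fun r x y => by ext (i | i) <;> fin_cases i <;> simp <;> ring))

omit [CharP k 2] in
lemma tensorSquareMap_tmul (δ : k) (x x' y y' : Fin 1 → k) :
    tensorSquareMap δ (Sum.elim x x' ⊗ₜ[k] Sum.elim y y') = Sum.elim
      ![x 0 * y' 0, δ * (x 0 * y 0 + x 0 * y' 0)] ![x' 0 * y' 0, δ * (x' 0 * y 0 + x 0 * y' 0)] :=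
  rfl

/-- Applies to both generators: `T = 1`, `S = 1` and `T`, `S` the Jordan blocks. -/
lemma tensorSquareMap_equivariant {α δ : k} (T : Matrix (Fin 1) (Fin 1) k)
    (S : Matrix (Fin 2) (Fin 2) k) (hT : T = !![α]) (hS : S 0 0 = α ∧ S 0 1 = 0 ∧ S 1 1 = α)
    (h : δ * (α * α + α) = S 1 0) (t : (Fin 1 ⊕ Fin 1 → k) ⊗[k] (Fin 1 ⊕ Fin 1 → k)) :
    tensorSquareMap δ (TensorProduct.map (toLin' (fromBlocks 1 T 0 1))
      (toLin' (fromBlocks 1 T 0 1)) t) = toLin' (fromBlocks 1 S 0 1) (tensorSquareMap δ t) := by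
  have two : (2 : k) = 0 := CharTwo.two_eq_zero
  refine LinearMap.congr_fun
    (f := tensorSquareMap δ ∘ₗ TensorProduct.map (toLin' (fromBlocks 1 T 0 1))
      (toLin' (fromBlocks 1 T 0 1)))
    (g := toLin' (fromBlocks 1 S 0 1) ∘ₗ tensorSquareMap δ)
    (TensorProduct.ext' fun x y => ?_) t
  rw [← Sum.elim_comp_inl_inr x, ← Sum.elim_comp_inl_inr y, LinearMap.comp_apply,
    LinearMap.comp_apply, TensorProduct.map_tmul, toLin'_fromBlocks_apply, toLin'_fromBlocks_apply,
    tensorSquareMap_tmul, tensorSquareMap_tmul, toLin'_fromBlocks_apply, hT]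
  generalize x ∘ Sum.inl = x₁, x ∘ Sum.inr = x₂, y ∘ Sum.inl = y₁, y ∘ Sum.inr = y₂
  obtain ⟨h1, h2, h3⟩ := hS
  ext (i | i) <;> fin_cases i <;>
    simp only [Sum.elim_inl, Sum.elim_inr, Pi.add_apply, Matrix.mulVec, dotProduct,
      Fin.sum_univ_two, Fin.sum_univ_one, Fin.isValue, Fin.zero_eta, Fin.mk_one, cons_val_zero,
      cons_val_one, of_apply, cons_val_fin_one, h1, h2, h3, ← h]
  · ring
  · ring
  · linear_combination α * δ * x₂ 0 * y₂ 0 * two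

/-- For `α ≠ 0, 1` the tensor square of `V_1(α)` is `V_2(α)`. -/
lemma idealOf_moduleV_one_two {α : k} (h0 : α ≠ 0) (h1 : α ≠ 1) :
    idealOf (moduleV 1 (α : OnePoint k)) (moduleV 2 (α : OnePoint k)) := by
  have two : (2 : k) = 0 := CharTwo.two_eq_zero
  have hD : α * α + α ≠ 0 := by
    intro h
    have : α * (α - 1) = 0 := by linear_combination h - α * two
    rcases mul_eq_zero.1 this with h | h
    · exact h0 h
    · exact h1 (sub_eq_zero.1 h)
  obtain ⟨δ, hδ⟩ : ∃ δ, δ * (α * α + α) = 1 := ⟨_, inv_mul_cancel₀ hD⟩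
  let V := moduleV 1 (α : OnePoint k)
  let U := moduleV 2 (α : OnePoint k)
  let a : V4 := Multiplicative.ofAdd (1, 0)
  let b : V4 := Multiplicative.ofAdd (0, 1)
  have hV : IsPencil (pencilRep 1 (jordanBlock 1 α)) a b 1 (jordanBlock 1 α) := isPencil_finite _ _
  have hU : IsPencil (pencilRep 1 (jordanBlock 2 α)) a b 1 (jordanBlock 2 α) := isPencil_finite _ _
  have hsurj : Function.Surjective (tensorSquareMap δ) := by
    intro w
    let e : Fin 1 ⊕ Fin 1 → k := Sum.elim 0 1
    let f : Fin 1 ⊕ Fin 1 → k := Sum.elim 1 0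
    refine ⟨w (Sum.inr 0) • (e ⊗ₜ e) + (w (Sum.inr 1) * (α * α + α)) • (e ⊗ₜ f) +
      w (Sum.inl 0) • (f ⊗ₜ e + e ⊗ₜ f + f ⊗ₜ f) + (w (Sum.inl 1) * (α * α + α)) • (f ⊗ₜ f), ?_⟩
    simp only [map_add, map_smul, e, f, tensorSquareMap_tmul]
    ext (i | i) <;> fin_cases i <;> simp
    · linear_combination w (Sum.inl 1) * hδ + w (Sum.inl 0) * δ * two
    · linear_combination w (Sum.inr 1) * hδ + w (Sum.inl 0) * δ * two
  have hra : ∀ t, tensorSquareMap δ (TensorProduct.map (pencilRep 1 (jordanBlock 1 α) a)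
      (pencilRep 1 (jordanBlock 1 α) a) t) =
      pencilRep 1 (jordanBlock 2 α) a (tensorSquareMap δ t) := by
    rw [hV.map_a, hU.map_a]
    refine tensorSquareMap_equivariant (α := 1) _ _ ?_ (by simp) ?_
    · ext i j; fin_cases i; fin_cases j; rfl
    · simp
      exact Or.inr (CharTwo.add_self_eq_zero 1)
  have hrb : ∀ t, tensorSquareMap δ (TensorProduct.map (pencilRep 1 (jordanBlock 1 α) b)
      (pencilRep 1 (jordanBlock 1 α) b) t) =
      pencilRep 1 (jordanBlock 2 α) b (tensorSquareMap δ t) := by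
    rw [hV.map_b, hU.map_b]
    refine tensorSquareMap_equivariant (α := α) _ _ ?_ (by simp [jordanBlock]) ?_
    · ext i j; fin_cases i; fin_cases j; rfl
    · simp [jordanBlock, hδ]
  have hinj : Function.Injective (tensorSquareMap δ) := by
    refine (LinearMap.injective_iff_surjective_of_finrank_eq_finrank ?_).2 hsurj
    simp [Module.finrank_tensorProduct]
  let r : MonoidalCategoryStruct.tensorObj V V ⟶ U := homMk (tensorSquareMap δ)
    (hU.equivariant (X := MonoidalCategoryStruct.tensorObj V V) (Y := U) _ hra hrb)
  have hm : Mono r := (mono_iff r).2 hinj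
  have he : Epi r := (epi_iff r).2 hsurj
  have := isIso_of_mono_of_epi r
  exact ⟨V, ⟨.ofIso (asIso r).symm⟩⟩

end FDRep

/-! ### Comparison of the ideals -/

namespace FDRep

open Matrix

variable {k : Type u} [Field k]

lemma isNilpotent_jordanBlock_zero (n : ℕ) : IsNilpotent (jordanBlock n (0 : k)) :=
  ⟨n, jordanBlock_zero_pow_eq_zero le_rfl⟩

lemma not_isNilpotent_of_mul_eq_one {n : ℕ} (hn : 1 ≤ n) {A C : Matrix (Fin n) (Fin n) k}
    (h : A * C = 1) : ¬ IsNilpotent A ∧ ¬ IsNilpotent C := by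
  have : Nonempty (Fin n) := ⟨⟨0, hn⟩⟩
  exact ⟨fun hA => hA.not_isUnit (IsUnit.of_mul_eq_one C h),
    fun hC => hC.not_isUnit (IsUnit.of_mul_eq_one A (mul_eq_one_comm.1 h))⟩

variable [CharP k 2]

lemma not_projective_moduleV {n : ℕ} (hn : 1 ≤ n) (α : OnePoint k) :
    ¬ Projective (moduleV n α) := by
  obtain ⟨ρ, e, h⟩ := exists_isPencil n α
  rw [e]
  exact h.not_projective hn

lemma not_isZero_moduleV {n : ℕ} (hn : 1 ≤ n) (α : OnePoint k) : ¬ IsZero (moduleV n α) :=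
  fun h => not_projective_moduleV hn α h.projective

lemma slopeBounded_of_idealOf_moduleV {n N : ℕ} {α : OnePoint k}
    (hN : n < N ∨ n = N ∧ (2 ≤ n ∨ pencilSlope α * pencilSlope α + pencilSlope α = 0))
    {Y : FDRep k V4} (hY : idealOf (moduleV n α) Y) :
    SlopeBounded (firstGen α) (secondGen α) (pencilSlope α) N Y := by
  obtain ⟨ρ, e, h⟩ := exists_isPencil n α
  rw [e] at hY
  exact h.slopeBounded hN hY

/-- The slope bound at `β` singles out the modules `V_m(β)` with `m ≤ N` among all `V_m(α)`. -/
lemma eq_and_le_of_slopeBounded_moduleV {m N : ℕ} (hm : 1 ≤ m) {α β : OnePoint k}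
    (h : SlopeBounded (firstGen β) (secondGen β) (pencilSlope β) N (moduleV m α)) :
    α = β ∧ m ≤ N := by
  match α, β, h with
  | none, none, h =>
    obtain ⟨C, hC, hN⟩ := (isPencil_infinite (jordanBlock m (0 : k)) 1).exists_inverse h
    rw [one_mul] at hC
    rw [hC, mul_one, pencilSlope, zero_smul, add_zero] at hN
    exact ⟨rfl, le_of_jordanBlock_zero_pow_eq_zero hN⟩
  | none, some y, h =>
    obtain ⟨C, hC, hN⟩ := (isPencil_finite (jordanBlock m (0 : k)) 1).exists_inverse h
    exact absurd (isNilpotent_jordanBlock_zero m) (not_isNilpotent_of_mul_eq_one hm hC).1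
  | some x, none, h =>
    obtain ⟨C, hC, hN⟩ := (isPencil_infinite 1 (jordanBlock m x)).exists_inverse h
    rw [one_mul, pencilSlope, zero_smul, add_zero] at hN
    exact absurd ⟨N, hN⟩ (not_isNilpotent_of_mul_eq_one hm hC).2
  | some x, some y, h =>
    obtain ⟨C, hC, hN⟩ := (isPencil_finite 1 (jordanBlock m x)).exists_inverse h
    rw [one_mul] at hC
    rw [hC, mul_one, pencilSlope, jordanBlock_eq m x, add_assoc, ← add_smul] at hN
    have hc : Commute (jordanBlock m 0 + (x + y) • (1 : Matrix (Fin m) (Fin m) k))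
        (jordanBlock m 0) :=
      (Commute.refl _).add_left ((Commute.one_left _).smul_left _)
    obtain ⟨l, hl⟩ := hc.isNilpotent_sub ⟨N, hN⟩ (isNilpotent_jordanBlock_zero m)
    rw [add_sub_cancel_left, smul_pow, one_pow] at hl
    have hxy : (x + y) ^ l = 0 := by
      simpa using congrFun (congrFun hl ⟨0, hm⟩) ⟨0, hm⟩
    have hxy' : x + y = 0 := eq_zero_of_pow_eq_zero hxy
    rw [hxy', zero_smul, add_zero] at hN
    exact ⟨congrArg some (CharTwo.add_eq_zero.1 hxy'), le_of_jordanBlock_zero_pow_eq_zero hN⟩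

lemma idealOf_moduleV_le {m n : ℕ} (hmn : m < n) (α : OnePoint k) :
    idealOf (moduleV m α) ≤ idealOf (moduleV n α) := by
  obtain ⟨ρ, e, h⟩ := exists_isPencil m α
  obtain ⟨ρ', e', h'⟩ := exists_isPencil n α
  rw [e, e', idealOf_le_iff]
  refine h'.idealOf_of_slopePair (by omega) h.isSlopePair ((slope_pow _ _).trans ?_)
  rw [jordanBlock_zero_pow_eq_zero hmn.le, jordanBlock_zero_pow_eq_zero (by omega : m ≤ n - 1),
    zero_mul, smul_zero, fromBlocks_zero, map_zero]

lemma idealOf_moduleV_lt {m n : ℕ} (hmn : m < n) (α : OnePoint k)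
    (h : m + 1 < n ∨ 2 ≤ m ∨ pencilSlope α * pencilSlope α + pencilSlope α = 0) :
    idealOf (moduleV m α) < idealOf (moduleV n α) := by
  refine lt_of_le_not_ge (idealOf_moduleV_le hmn α) fun hle => ?_
  have hn := idealOf_le_iff.1 hle
  rcases h with h | h
  · have := (eq_and_le_of_slopeBounded_moduleV (by omega)
      (slopeBounded_of_idealOf_moduleV (N := m + 1) (Or.inl (by omega)) hn)).2
    omega
  · have := (eq_and_le_of_slopeBounded_moduleV (by omega)
      (slopeBounded_of_idealOf_moduleV (N := m) (Or.inr ⟨rfl, h⟩) hn)).2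
    omega

lemma not_idealOf_moduleV_unit (n : ℕ) (α : OnePoint k) : ¬ idealOf (moduleV n α) (moduleK k) := by
  intro h
  -- the trivial module is not free over the subgroup generated by `firstGen α`
  obtain ⟨u, hu⟩ := (slopeBounded_of_idealOf_moduleV (Or.inl (Nat.lt_succ_self n)) h).lift
    (1 : k) rfl
  have hu' : (u : k) = (u : k) + 1 := hu
  simp at hu'

variable (k) in
/-- Otherwise all modules would be projective. -/
lemma not_projective_unit : ¬ Projective (moduleK k) := by
  intro h
  have h1 : idealOf (regular k V4) (moduleK k) := by
    rw [← isProjective_eq_idealOf_regular]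
    exact h
  have h2 := idealOf_le_iff.2 h1
  rw [idealOf_unit, ← isProjective_eq_idealOf_regular] at h2
  exact not_projective_moduleV (k := k) le_rfl (OnePoint.infty) (h2 _ trivial)

end FDRep

open FDRep in
theorem propositionP (k : Type u) [Field k] [IsAlgClosed k] [CharP k 2] :
    -- the ideal of projectives is generated by `D` and lies in every (nonzero) ideal
    ((CategoryTheory.isProjective (FDRep k V4) = idealOf (moduleD k)) ∧
      (∀ I : CategoryTheory.ObjectProperty (FDRep k V4), IsTensorIdeal I →
        (∃ X : FDRep k V4, I X ∧ ¬ CategoryTheory.Limits.IsZero X) →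
        CategoryTheory.isProjective (FDRep k V4) ≤ I)) ∧
    -- the Heller shifts of the trivial module exist and generate the whole category
    (idealOf (moduleK k) = ⊤ ∧
      ∀ n : ℤ, (∃ M : FDRep k V4, IsHellerShift n M (moduleK k)) ∧
        ∀ M : FDRep k V4, IsHellerShift n M (moduleK k) → idealOf M = idealOf (moduleK k)) ∧
    -- the chain at infinity
    (∀ m n : ℕ, 1 ≤ m → m < n →
      idealOf (moduleV m (OnePoint.infty : OnePoint k)) < idealOf (moduleV n OnePoint.infty)) ∧
    -- the chain at a finite point, which is strict except possibly at its first step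
    (∀ (α : k) (m n : ℕ), 1 ≤ m → m < n → ¬ (m = 1 ∧ n = 2 ∧ α ≠ 0 ∧ α ≠ 1) →
      idealOf (moduleV m (α : OnePoint k)) < idealOf (moduleV n (α : OnePoint k))) ∧
    -- the exceptional equality
    (∀ α : k, α ≠ 0 → α ≠ 1 →
      idealOf (moduleV 2 (α : OnePoint k)) = idealOf (moduleV 1 (α : OnePoint k))) ∧
    -- each chain lies strictly between the projectives and the whole category
    (∀ (α : OnePoint k) (n : ℕ), 1 ≤ n →
      CategoryTheory.isProjective (FDRep k V4) < idealOf (moduleV n α) ∧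
        idealOf (moduleV n α) < idealOf (moduleK k)) ∧
    -- there are no containments between chains attached to different points
    (∀ (α β : OnePoint k) (m n : ℕ), 1 ≤ m → 1 ≤ n → α ≠ β →
      ¬ idealOf (moduleV m α) ≤ idealOf (moduleV n β)) := by
  refine ⟨⟨isProjective_eq_idealOf_regular k V4,
    fun I hI ⟨X, hX, h0⟩ => projective_le_ideal hI hX h0⟩,
    ⟨idealOf_unit, fun n => ⟨exists_isHellerShift n _,
      fun M hM => idealOf_isHellerShift (not_projective_unit k) hM⟩⟩,
    fun m n _ hmn => idealOf_moduleV_lt hmn _ (Or.inr (Or.inr (show (0 : k) * 0 + 0 = 0 by simp))),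
    fun α m n hm hmn hex => idealOf_moduleV_lt hmn _ ?_,
    fun α h0 h1 => le_antisymm (idealOf_le_iff.2 (idealOf_moduleV_one_two h0 h1))
      (idealOf_moduleV_le one_lt_two _),
    fun α n hn => ⟨?_, ?_⟩, fun α β m n hm _ hne hle => hne ?_⟩
  · by_cases h2 : 2 ≤ m
    · exact Or.inr (Or.inl h2)
    by_cases h3 : m + 1 < n
    · exact Or.inl h3
    refine Or.inr (Or.inr ?_)
    show α * α + α = 0
    by_cases h0 : α = 0
    · simp [h0]
    by_cases h1 : α = 1
    · rw [h1, mul_one, CharTwo.add_self_eq_zero]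
    exact absurd ⟨by omega, by omega, h0, h1⟩ hex
  · refine lt_of_le_not_ge (projective_le_ideal (isTensorIdeal_idealOf _) (idealOf_self _)
      (not_isZero_moduleV hn α)) fun h => not_projective_moduleV hn α (h _ (idealOf_self _))
  · rw [show idealOf (moduleK k) = ⊤ from idealOf_unit, lt_top_iff_ne_top]
    intro h
    exact not_idealOf_moduleV_unit n α (h ▸ trivial)
  · exact (eq_and_le_of_slopeBounded_moduleV hm
      (slopeBounded_of_idealOf_moduleV (N := n + 1) (Or.inl (Nat.lt_succ_self n))
        (idealOf_le_iff.1 hle))).1
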